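/- Let $n\ge 2$ and $b>0$, and let $u$ be a smooth function on the punctured ball $\Omega=\{x\in\mathbb R^n: 0<|x|<b\}$ which is radial, $u=u(r)$ with $r=|x|$. Let $g=I+(D^2u)^TD^2u$ be the metric induced on the gradient graph $\Gamma=\{(x,Du(x)):x\in\Omega\}\subset\mathbb R^n\times\mathbb R^n$, and let $\theta=\sum_{i=1}^n\arctan\lambda_i$, where $\lambda_1,\dots,\lambda_n$ are the eigenvalues of $D^2u$. Suppose that $u$ solves the Hamiltonian stationary equation $\Delta_g\theta=0$ on $\Omega$, where $\Delta_g$ is the Laplace--Beltrami operator of $g$. Let $\bar\Gamma$ be the completed graph, i.e. the closure of $\Gamma$ in $\{(x,y)\in\mathbb R^n\times\mathbb R^n:|x|<b\}$. (1) If $\lim_{r\to0^+}u'(r)=0$, then $u$ solves the special Lagrangian equation $\nabla_g\theta=0$ on $\Omega$; in fact there are constants $a,k\in\mathbb R$ with $u(x)=a+\frac k2|x|^2$ on $\Omega$, and $\bar\Gamma$ is a flat $n$-dimensional disk, i.e. an open ball in an $n$-dimensional affine subspace of $\mathbb R^{2n}$. (2) If $\lim_{r\to0^+}u'(r)=c$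 with $c\in\mathbb R$, $c\neq0$, then $\bar\Gamma=\Gamma\cup S$, where $S=\{(0,y):|y|=|c|\}$ is the sphere over the origin, and $\Gamma\cup S$ is a properly embedded half cylinder with boundary $S$: it is the image of an injective immersion of $[0,\infty)\times\mathbb S^{n-1}$, smooth up to the boundary and proper as a map into $\{(x,y):|x|<b\}$, that takes $\{0\}\times\mathbb S^{n-1}$ onto $S$. -/

import Mathlib

open Set Filter Topology Metric
open scoped Manifold ContDiff Gradient

noncomputable section

/-- Euclidean `n`-space. -/
abbrev Euc (n : ℕ) : Type := EuclideanSpace ℝ (Fin n)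

/-- The space `ℝⁿ × ℝⁿ = ℝ²ⁿ`, with the Euclidean norm. -/
abbrev Amb (n : ℕ) : Type := WithLp 2 (Euc n × Euc n)

/-- Needed for the manifold structure of the unit sphere of `ℝⁿ`. -/
instance instFactFinrankEuc (n : ℕ) [NeZero n] :
    Fact (Module.finrank ℝ (Euc n) = (n - 1) + 1) :=
  ⟨by
    have h : n ≠ 0 := NeZero.ne n
    rw [finrank_euclideanSpace_fin]
    omega⟩

/-- The unit sphere of `ℝⁿ`. -/
abbrev UnitSphere (n : ℕ) : Type := sphere (0 : Euc n) 1

/-- The punctured ball `{x ∈ ℝⁿ : 0 < |x| < b}`. -/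
def puncturedBall (n : ℕ) (b : ℝ) : Set (Euc n) := {x | 0 < ‖x‖ ∧ ‖x‖ < b}

/-- The partial derivative `∂ᵢ φ`. -/
def partialD {n : ℕ} (i : Fin n) (φ : Euc n → ℝ) (x : Euc n) : ℝ :=
  fderiv ℝ φ x (EuclideanSpace.single i 1)

/-- The Hessian matrix `D²u`. -/
def hessianMatrix {n : ℕ} (u : Euc n → ℝ) (x : Euc n) : Matrix (Fin n) (Fin n) ℝ :=
  Matrix.of fun i j => partialD i (partialD j u) x

/-- The metric `g = I + (D²u)ᵀ D²u` induced on the gradient graph `x ↦ (x, Du(x))` by the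
Euclidean metric of `ℝ²ⁿ`, in the coordinates `x`. -/
def graphMetric {n : ℕ} (u : Euc n → ℝ) (x : Euc n) : Matrix (Fin n) (Fin n) ℝ :=
  1 + (hessianMatrix u x).transpose * hessianMatrix u x

/-- The Lagrangian phase `θ = ∑ arctan λᵢ`, where the `λᵢ` are the eigenvalues of `D²u`, counted
with multiplicity. -/
def lagrangianPhase {n : ℕ} (u : Euc n → ℝ) (x : Euc n) : ℝ :=
  ((hessianMatrix u x).charpoly.roots.map Real.arctan).sum

/-- The components `∑ⱼ gⁱʲ ∂ⱼφ` of the gradient of `φ` for the induced metric. -/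
def graphGradient {n : ℕ} (u φ : Euc n → ℝ) (x : Euc n) (i : Fin n) : ℝ :=
  ∑ j, (graphMetric u x)⁻¹ i j * partialD j φ x

/-- The Laplace-Beltrami operator of the induced metric,
`Δ_g φ = (1/√det g) ∑ᵢ ∂ᵢ (√det g ∑ⱼ gⁱʲ ∂ⱼφ)`. -/
def graphLaplacian {n : ℕ} (u φ : Euc n → ℝ) (x : Euc n) : ℝ :=
  (1 / √(graphMetric u x).det) *
    ∑ i, partialD i (fun y => √(graphMetric u y).det * graphGradient u φ y i) x

/-- `u` is a smooth solution on `Ω` of the Hamiltonian stationary equation `Δ_g θ = 0`. -/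
def IsHamiltonianStationary {n : ℕ} (u : Euc n → ℝ) (Ω : Set (Euc n)) : Prop :=
  ContDiffOn ℝ ∞ u Ω ∧ ∀ x ∈ Ω, graphLaplacian u (lagrangianPhase u) x = 0

/-- `u` is a smooth solution on `Ω` of the special Lagrangian equation `∇θ = 0`. -/
def IsSpecialLagrangian {n : ℕ} (u : Euc n → ℝ) (Ω : Set (Euc n)) : Prop :=
  ContDiffOn ℝ ∞ u Ω ∧ ∀ x ∈ Ω, graphGradient u (lagrangianPhase u) x = 0

/-- The gradient graph `{(x, Du(x)) : x ∈ Ω}`. -/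
def gradientGraph {n : ℕ} (u : Euc n → ℝ) (Ω : Set (Euc n)) : Set (Amb n) :=
  {z | z.fst ∈ Ω ∧ z.snd = ∇ u z.fst}

/-- The open tube `{(x, y) : |x| < b}` over the ball of radius `b`. -/
def tube (n : ℕ) (b : ℝ) : Set (Amb n) := {z | ‖z.fst‖ < b}

/-- The gradient graph over the punctured ball, completed over the origin: its closure in the
tube over the ball. -/
def completedGraph {n : ℕ} (u : Euc n → ℝ) (b : ℝ) : Set (Amb n) :=
  closure (gradientGraph u (puncturedBall n b)) ∩ tube n b

/-- The sphere `{0} × {|y| = ρ}` over the origin. -/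
def sphereOverOrigin (n : ℕ) (ρ : ℝ) : Set (Amb n) := {z | z.fst = 0 ∧ ‖z.snd‖ = ρ}

/-- An (open) flat `n`-disk in `ℝ²ⁿ`: a round ball of an `n`-dimensional affine subspace. -/
def IsFlatDisk {n : ℕ} (M : Set (Amb n)) : Prop :=
  ∃ (p : Amb n) (L : Submodule ℝ (Amb n)) (R : ℝ),
    Module.finrank ℝ L = n ∧ 0 < R ∧ M = {z | z - p ∈ L ∧ ‖z - p‖ < R}

/-- The half cylinder `[0, ∞) × Sⁿ⁻¹`, inside the manifold `ℝ × Sⁿ⁻¹`. -/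
def halfCylinder (n : ℕ) : Set (ℝ × UnitSphere n) := Ici 0 ×ˢ univ

/-- `M` is a smooth half cylinder with boundary `B`, properly embedded in the open set `U`: it is
the image of `[0, ∞) × Sⁿ⁻¹` under an injective immersion, smooth up to the boundary and proper
as a map into `U`, that takes the boundary `{0} × Sⁿ⁻¹` onto `B`. -/
def IsProperlyEmbeddedHalfCylinder {n : ℕ} [NeZero n] (M B U : Set (Amb n)) : Prop :=
  M ⊆ U ∧ ∃ F : ℝ × UnitSphere n → Amb n,
    ContMDiffOn (𝓘(ℝ, ℝ).prod (𝓡 (n - 1))) 𝓘(ℝ, Amb n) ∞ F (halfCylinder n) ∧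
    (∀ p ∈ halfCylinder n, Function.Injective
      (mfderivWithin (𝓘(ℝ, ℝ).prod (𝓡 (n - 1))) 𝓘(ℝ, Amb n) F (halfCylinder n) p)) ∧
    InjOn F (halfCylinder n) ∧
    (∀ K ⊆ U, IsCompact K → IsCompact (halfCylinder n ∩ F ⁻¹' K)) ∧
    F '' halfCylinder n = M ∧
    F '' ({0} ×ˢ univ) = B

end

/-!
Write `v = f'` for the slope of the radial potential. The Hessian of `f(|x|)` acts as `v'` on the
radial line and as `v / r` on its orthogonal complement, so it and the induced metric belong to the
commutative algebra of matrices `axialMatrix`, in which determinants, inverses and spectra are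
explicit. The phase is `Θ(|x|)` with `Θ = arctan v' + (n - 1) arctan (v / r)` (`phaseProfile`), and
`√det g ∇_g θ` is a radial field `S(|x|) x`. The equation `Δ_g θ = 0` says that this field has
divergence zero, that is, `rⁿ S` is a constant `C` (`exists_phaseProfile_deriv`). In terms of the
curve `(r, v(r))` in the half plane, with arclength `s` and distance `ρ = √(r² + v²)` to the origin,
this reads `ρⁿ⁻¹ dΘ/ds = C`.

If `v → 0`, the curve runs into the origin. As `ds ≥ |dρ|` and `n ≥ 2`, the integral of `ρ¹⁻ⁿ ds`
diverges there while `Θ` is bounded, so `C = 0` (`flux_eq_zero`) and `Θ = Θ₀` is constant. Then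
`Im (e^{-iΘ₀} (r + i v)ⁿ)` has derivative zero and tends to `0` at the origin, so it vanishes, which
leaves only discretely many values for `arctan (v / r)`: the potential is quadratic
(`deriv_eq_mul_of_phase_const`), and the completed graph is a piece of the graph of `x ↦ k x`.

If `v → c ≠ 0`, the equation `ρⁿ⁻¹ dΘ/ds = C`, rewritten for the tangent angle `φ = arctan v'`, is
an ordinary differential equation for `(r, v, φ)` that is smooth near `r = 0`, since it is singular
only at `ρ = 0`. The curvature of the curve is therefore bounded near its end point `(0, c)`, which
makes `sin φ` Lipschitz in `r`: the tangent angle has a limit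
(`exists_tendsto_arctan_deriv`) and the curve has finite length near `r = 0`. So the curve reaches
its end point in finite time as a trajectory of a smooth vector field, and a trajectory that is
continuous up to the initial time is smooth up to it (`contDiffOn_Ici_of_trajectory`). The tangent
may be vertical at the end point, so `v` itself need not be smooth up to `r = 0`; this is why the
curve is parametrized by time. Running it at speed `b - r` turns the parameter interval into
`[0, ∞)` (`exists_time_change`), and rotating the curve, `(t, ω) ↦ (R(t) ω, V(t) ω)`, gives the half
cylinder (`isProperlyEmbeddedHalfCylinder_sweep`).
-/

noncomputable section

/-! ### Symmetric matrices with a distinguished axis -/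

/-- The matrix acting as `m` on the line spanned by `x` and as `p` on the orthogonal complement of
`x`; this reading needs `s = |x|² ≠ 0`. -/
def axialMatrix {n : ℕ} (x : Fin n → ℝ) (s p m : ℝ) : Matrix (Fin n) (Fin n) ℝ :=
  p • 1 + ((m - p) / s) • Matrix.vecMulVec x x

section axial
variable {n : ℕ} {x : Fin n → ℝ} {s : ℝ}

lemma axialMatrix_add (p m p' m' : ℝ) :
    axialMatrix x s p m + axialMatrix x s p' m' = axialMatrix x s (p + p') (m + m') := by
  ext i j
  simp only [axialMatrix, Matrix.add_apply, Matrix.smul_apply, smul_eq_mul, Matrix.vecMulVec_apply]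
  ring

lemma axialMatrix_self (p : ℝ) : axialMatrix x s p p = p • 1 := by
  simp [axialMatrix]

lemma axialMatrix_transpose (p m : ℝ) :
    (axialMatrix x s p m).transpose = axialMatrix x s p m := by
  simp [axialMatrix, Matrix.transpose_vecMulVec]

lemma axialMatrix_mul (hs : s ≠ 0) (hx : x ⬝ᵥ x = s) (p m p' m' : ℝ) :
    axialMatrix x s p m * axialMatrix x s p' m' = axialMatrix x s (p * p') (m * m') := by
  have h : Matrix.vecMulVec x x * Matrix.vecMulVec x x = s • Matrix.vecMulVec x x := by
    rw [Matrix.vecMulVec_mul_vecMulVec, hx]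
    ext i j
    simp [Matrix.vecMulVec_apply]
    ring
  simp only [axialMatrix, add_mul, mul_add, Matrix.smul_mul, Matrix.mul_smul, one_mul, mul_one, h]
  ext i j
  simp only [Matrix.add_apply, Matrix.smul_apply, smul_eq_mul]
  field_simp
  ring

lemma axialMatrix_inv (hs : s ≠ 0) (hx : x ⬝ᵥ x = s) {p m : ℝ} (hp : p ≠ 0) (hm : m ≠ 0) :
    (axialMatrix x s p m)⁻¹ = axialMatrix x s p⁻¹ m⁻¹ := by
  apply Matrix.inv_eq_right_inv
  rw [axialMatrix_mul hs hx, mul_inv_cancel₀ hp, mul_inv_cancel₀ hm, axialMatrix_self, one_smul]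

lemma axialMatrix_mulVec (hs : s ≠ 0) (hx : x ⬝ᵥ x = s) (p m : ℝ) :
    (axialMatrix x s p m).mulVec x = m • x := by
  ext i
  simp only [axialMatrix, Matrix.add_mulVec, Matrix.smul_mulVec, Matrix.one_mulVec,
    Matrix.vecMulVec_mulVec, hx, Pi.add_apply, Pi.smul_apply, smul_eq_mul, MulOpposite.smul_eq_mul_unop,
    MulOpposite.unop_op]
  field_simp
  ring

open Polynomial in
lemma axialMatrix_charpoly (hn : 1 ≤ n) (hs : s ≠ 0) (hx : x ⬝ᵥ x = s) (p m : ℝ) :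
    (axialMatrix x s p m).charpoly = (X - C p) ^ (n - 1) * (X - C m) := by
  have h1 : axialMatrix x s p m
      = Matrix.vecMulVec (((m - p) / s) • x) x - Matrix.scalar (Fin n) (-p) := by
    ext i j
    simp only [axialMatrix, Matrix.scalar_apply, Matrix.smul_vecMulVec, Matrix.add_apply,
      Matrix.sub_apply, Matrix.smul_apply, smul_eq_mul, Matrix.diagonal_apply, Matrix.one_apply]
    split_ifs <;> ring
  obtain ⟨k, rfl⟩ : ∃ k, n = k + 1 := ⟨n - 1, by omega⟩
  have h2 : (m - p) / s * s = m - p := by field_simp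
  rw [h1, Matrix.charpoly_sub_scalar, Matrix.charpoly_vecMulVec, smul_dotProduct, hx, smul_eq_mul,
    h2]
  simp only [Fintype.card_fin, Nat.add_sub_cancel, Polynomial.smul_eq_C_mul, map_neg, map_sub,
    sub_comp, pow_comp, mul_comp, C_comp, X_comp]
  ring

lemma axialMatrix_det (hn : 1 ≤ n) (hs : s ≠ 0) (hx : x ⬝ᵥ x = s) (p m : ℝ) :
    (axialMatrix x s p m).det = p ^ (n - 1) * m := by
  have h := Matrix.eval_charpoly (axialMatrix x s (-p) (-m)) 0
  have h2 : Matrix.scalar (Fin n) (0 : ℝ) - axialMatrix x s (-p) (-m) = axialMatrix x s p m := by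
    ext i j
    simp [axialMatrix]
    ring
  rw [h2, axialMatrix_charpoly hn hs hx] at h
  simpa using h.symm

lemma axialMatrix_sum_arctan (hn : 1 ≤ n) (hs : s ≠ 0) (hx : x ⬝ᵥ x = s) (p m : ℝ) :
    ((axialMatrix x s p m).charpoly.roots.map Real.arctan).sum
      = Real.arctan m + (n - 1) * Real.arctan p := by
  open Polynomial in
  rw [axialMatrix_charpoly hn hs hx, roots_mul
    (mul_ne_zero (pow_ne_zero _ (X_sub_C_ne_zero _)) (X_sub_C_ne_zero _))]
  simp [Multiset.map_nsmul, Multiset.sum_nsmul, Nat.cast_sub hn, add_comm]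

end axial

/-! ### Calculus of radial functions -/

section radial
variable {n : ℕ} {b : ℝ}

lemma isOpen_puncturedBall (n : ℕ) (b : ℝ) : IsOpen (puncturedBall n b) :=
  (isOpen_lt continuous_const continuous_norm).inter (isOpen_lt continuous_norm continuous_const)

lemma hasFDerivAt_comp_norm {h : ℝ → ℝ} {h' : ℝ} {x : Euc n} (hx : x ≠ 0)
    (hh : HasDerivAt h h' ‖x‖) :
    HasFDerivAt (fun y : Euc n => h ‖y‖) ((h' / ‖x‖) • innerSL ℝ x) x := by
  have hx0 : ‖x‖ ≠ 0 := norm_ne_zero_iff.2 hx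
  have h1 : HasFDerivAt (fun y : Euc n => ‖y‖) ((1 / ‖x‖) • innerSL ℝ x) x := by
    have := (hasStrictFDerivAt_norm_sq x).hasFDerivAt.sqrt (by positivity)
    simp only [Real.sqrt_sq (norm_nonneg _)] at this
    convert! this using 1
    rw [two_smul, ← two_smul ℝ, smul_smul]
    congr 1
    field_simp
  convert! hh.comp_hasFDerivAt x h1 using 1
  rw [smul_smul]
  congr 1
  ring

lemma innerSL_single (x : Euc n) (i : Fin n) :
    innerSL ℝ x (EuclideanSpace.single i (1 : ℝ)) = x i := by
  rw [innerSL_apply_apply, EuclideanSpace.inner_single_right]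
  simp

lemma partialD_comp_norm {φ : Euc n → ℝ} {h : ℝ → ℝ} {h' : ℝ} {x : Euc n} (hx : x ≠ 0)
    (hh : HasDerivAt h h' ‖x‖) (hφ : φ =ᶠ[𝓝 x] fun y => h ‖y‖) (i : Fin n) :
    partialD i φ x = h' / ‖x‖ * x i := by
  rw [partialD, hφ.fderiv_eq, (hasFDerivAt_comp_norm hx hh).fderiv,
    smul_apply, innerSL_single, smul_eq_mul]

lemma partialD_comp_norm_mul_coord {φ : Euc n → ℝ} {h : ℝ → ℝ} {h' : ℝ} {x : Euc n} (hx : x ≠ 0)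
    (hh : HasDerivAt h h' ‖x‖) (j : Fin n) (hφ : φ =ᶠ[𝓝 x] fun y => h ‖y‖ * y j) (i : Fin n) :
    partialD i φ x = h' / ‖x‖ * (x i * x j) + h ‖x‖ * if i = j then 1 else 0 := by
  have h2 : HasFDerivAt (fun y : Euc n => y j) (EuclideanSpace.proj j : Euc n →L[ℝ] ℝ) x :=
    (EuclideanSpace.proj j : Euc n →L[ℝ] ℝ).hasFDerivAt
  have h3 : HasFDerivAt (fun y : Euc n => h ‖y‖ * y j) _ x := (hasFDerivAt_comp_norm hx hh).mul h2
  rw [partialD, hφ.fderiv_eq, h3.fderiv]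
  simp only [add_apply, smul_apply, innerSL_single,
    smul_eq_mul, PiLp.proj_apply, PiLp.single_apply, eq_comm (a := j) (b := i)]
  ring

lemma dotProduct_self_eq_norm_sq (x : Euc n) : (x : Fin n → ℝ) ⬝ᵥ x = ‖x‖ ^ 2 := by
  rw [EuclideanSpace.real_norm_sq_eq]
  simp [dotProduct, sq]

end radial

/-! ### The Hamiltonian stationary equation for radial potentials -/

/-- The Lagrangian phase of the radial potential `f(|x|)` as a function of the radius: the Hessian
has the eigenvalue `f''` in the radial direction and `f' / r` in the `n - 1` tangential ones. -/
def phaseProfile (n : ℕ) (f : ℝ → ℝ) (r : ℝ) : ℝ :=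
  Real.arctan (deriv (deriv f) r) + (n - 1) * Real.arctan (deriv f r / r)

/-- The function `S` for which `√det g ∇_g θ = S(|x|) x` when the potential is `f(|x|)`. -/
def fluxProfile (n : ℕ) (f : ℝ → ℝ) (r : ℝ) : ℝ :=
  √((1 + (deriv f r / r) ^ 2) ^ (n - 1) * (1 + deriv (deriv f) r ^ 2)) *
    (deriv (phaseProfile n f) r / (1 + deriv (deriv f) r ^ 2) / r)

section reduction
variable {n : ℕ} {b : ℝ} {u : Euc n → ℝ} {f : ℝ → ℝ}

lemma norm_mem_Ioo {x : Euc n} (hx : x ∈ puncturedBall n b) : ‖x‖ ∈ Ioo 0 b := hx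

lemma ne_zero_of_mem_puncturedBall {x : Euc n} (hx : x ∈ puncturedBall n b) : x ≠ 0 :=
  norm_pos_iff.1 hx.1

lemma smul_mem_puncturedBall {r : ℝ} (hr : r ∈ Ioo 0 b) {y : Euc n} (hy : ‖y‖ = 1) :
    r • y ∈ puncturedBall n b ∧ ‖r • y‖ = r := by
  have h : ‖r • y‖ = r := by rw [norm_smul, hy, mul_one, Real.norm_of_nonneg hr.1.le]
  refine ⟨?_, h⟩
  change 0 < ‖r • y‖ ∧ ‖r • y‖ < b
  rwa [h]

lemma exists_norm_eq_one (n : ℕ) [NeZero n] : ∃ y : Euc n, ‖y‖ = 1 :=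
  ⟨EuclideanSpace.single 0 1, by simp⟩

lemma contDiffOn_profile [NeZero n] (hradial : ∀ x ∈ puncturedBall n b, u x = f ‖x‖)
    (hsm : ContDiffOn ℝ ∞ u (puncturedBall n b)) : ContDiffOn ℝ ∞ f (Ioo 0 b) := by
  obtain ⟨y, hy⟩ := exists_norm_eq_one n
  have hsmul : ContDiff ℝ ∞ fun r : ℝ => r • y := contDiff_id.smul contDiff_const
  refine (hsm.comp hsmul.contDiffOn fun r hr => (smul_mem_puncturedBall hr hy).1).congr
    fun r hr => ?_
  rw [Function.comp_apply, hradial _ (smul_mem_puncturedBall hr hy).1,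
    (smul_mem_puncturedBall hr hy).2]

lemma ContDiffOn.deriv_Ioo {a b : ℝ} {h : ℝ → ℝ} (hh : ContDiffOn ℝ ∞ h (Ioo a b)) :
    ContDiffOn ℝ ∞ (deriv h) (Ioo a b) :=
  hh.deriv_of_isOpen isOpen_Ioo (by simp)

lemma ContDiffOn.hasDerivAt_Ioo {a b : ℝ} {h : ℝ → ℝ} (hh : ContDiffOn ℝ ∞ h (Ioo a b)) {r : ℝ}
    (hr : r ∈ Ioo a b) : HasDerivAt h (deriv h r) r :=
  ((hh.contDiffAt (isOpen_Ioo.mem_nhds hr)).differentiableAt (by simp)).hasDerivAt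

lemma contDiffOn_deriv_div (hf : ContDiffOn ℝ ∞ f (Ioo 0 b)) :
    ContDiffOn ℝ ∞ (fun r => deriv f r / r) (Ioo 0 b) :=
  hf.deriv_Ioo.div contDiffOn_id fun _ hr => hr.1.ne'

lemma contDiffOn_phaseProfile (hf : ContDiffOn ℝ ∞ f (Ioo 0 b)) :
    ContDiffOn ℝ ∞ (phaseProfile n f) (Ioo 0 b) :=
  (Real.contDiff_arctan.comp_contDiffOn hf.deriv_Ioo.deriv_Ioo).add
    (contDiffOn_const.mul (Real.contDiff_arctan.comp_contDiffOn (contDiffOn_deriv_div hf)))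

lemma contDiffOn_fluxProfile (hf : ContDiffOn ℝ ∞ f (Ioo 0 b)) :
    ContDiffOn ℝ ∞ (fluxProfile n f) (Ioo 0 b) := by
  have h2 : ContDiffOn ℝ ∞ (fun r => 1 + deriv (deriv f) r ^ 2) (Ioo 0 b) :=
    contDiffOn_const.add (hf.deriv_Ioo.deriv_Ioo.pow 2)
  refine ContDiffOn.mul (ContDiffOn.sqrt ?_ fun r _ => ?_) (ContDiffOn.div (ContDiffOn.div
    (contDiffOn_phaseProfile hf).deriv_Ioo h2 fun r _ => ?_) contDiffOn_id fun r hr => hr.1.ne')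
  · exact ((contDiffOn_const.add ((contDiffOn_deriv_div hf).pow 2)).pow _).mul h2
  · positivity
  · positivity

lemma eventuallyEq_of_puncturedBall {φ ψ : Euc n → ℝ} (h : ∀ x ∈ puncturedBall n b, φ x = ψ x)
    {x : Euc n} (hx : x ∈ puncturedBall n b) : φ =ᶠ[𝓝 x] ψ :=
  eventually_of_mem ((isOpen_puncturedBall n b).mem_nhds hx) h

lemma gradient_radial (hradial : ∀ x ∈ puncturedBall n b, u x = f ‖x‖)
    (hf : ContDiffOn ℝ ∞ f (Ioo 0 b)) {x : Euc n} (hx : x ∈ puncturedBall n b) :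
    ∇ u x = (deriv f ‖x‖ / ‖x‖) • x := by
  have h := (hasFDerivAt_comp_norm (ne_zero_of_mem_puncturedBall hx)
    (hf.hasDerivAt_Ioo (norm_mem_Ioo hx))).congr_of_eventuallyEq
      (eventuallyEq_of_puncturedBall hradial hx)
  rw [h.hasGradientAt.gradient, map_smul]
  congr 1
  exact (InnerProductSpace.toDual ℝ (Euc n)).symm_apply_apply x

lemma hessianMatrix_radial (hradial : ∀ x ∈ puncturedBall n b, u x = f ‖x‖)
    (hf : ContDiffOn ℝ ∞ f (Ioo 0 b)) {x : Euc n} (hx : x ∈ puncturedBall n b) :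
    hessianMatrix u x
      = axialMatrix x (‖x‖ ^ 2) (deriv f ‖x‖ / ‖x‖) (deriv (deriv f) ‖x‖) := by
  have hr := norm_mem_Ioo hx
  have h1 : ∀ j, ∀ y ∈ puncturedBall n b, partialD j u y = deriv f ‖y‖ / ‖y‖ * y j := fun j y hy =>
    partialD_comp_norm (ne_zero_of_mem_puncturedBall hy) (hf.hasDerivAt_Ioo (norm_mem_Ioo hy))
      (eventuallyEq_of_puncturedBall hradial hy) j
  have h2 := (hf.deriv_Ioo.hasDerivAt_Ioo hr).div (hasDerivAt_id ‖x‖) hr.1.ne'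
  ext i j
  have h3 := partialD_comp_norm_mul_coord (h := fun r => deriv f r / r)
    (ne_zero_of_mem_puncturedBall hx) h2 j (eventuallyEq_of_puncturedBall (h1 j) hx) i
  have h0 : ‖x‖ ≠ 0 := hr.1.ne'
  simp only [hessianMatrix, Matrix.of_apply, h3, axialMatrix, Matrix.add_apply, Matrix.smul_apply,
    smul_eq_mul, Matrix.vecMulVec_apply, Matrix.one_apply, id_eq]
  field_simp
  ring

lemma lagrangianPhase_radial [NeZero n] (hradial : ∀ x ∈ puncturedBall n b, u x = f ‖x‖)
    (hf : ContDiffOn ℝ ∞ f (Ioo 0 b)) : ∀ x ∈ puncturedBall n b,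
    lagrangianPhase u x = phaseProfile n f ‖x‖ := fun x hx => by
  rw [lagrangianPhase, hessianMatrix_radial hradial hf hx, axialMatrix_sum_arctan
    (NeZero.one_le) (pow_ne_zero 2 hx.1.ne') (dotProduct_self_eq_norm_sq x), phaseProfile]

lemma graphMetric_radial (hradial : ∀ x ∈ puncturedBall n b, u x = f ‖x‖)
    (hf : ContDiffOn ℝ ∞ f (Ioo 0 b)) {x : Euc n} (hx : x ∈ puncturedBall n b) :
    graphMetric u x = axialMatrix x (‖x‖ ^ 2) (1 + (deriv f ‖x‖ / ‖x‖) ^ 2)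
      (1 + deriv (deriv f) ‖x‖ ^ 2) := by
  have h1 : (1 : Matrix (Fin n) (Fin n) ℝ) = axialMatrix x (‖x‖ ^ 2) 1 1 := by
    rw [axialMatrix_self, one_smul]
  rw [graphMetric, hessianMatrix_radial hradial hf hx, axialMatrix_transpose, axialMatrix_mul
    (pow_ne_zero 2 hx.1.ne') (dotProduct_self_eq_norm_sq x), h1, axialMatrix_add, ← sq, ← sq]

lemma graphGradient_radial [NeZero n] (hradial : ∀ x ∈ puncturedBall n b, u x = f ‖x‖)
    (hf : ContDiffOn ℝ ∞ f (Ioo 0 b)) {x : Euc n} (hx : x ∈ puncturedBall n b) (i : Fin n) :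
    graphGradient u (lagrangianPhase u) x i
      = deriv (phaseProfile n f) ‖x‖ / (1 + deriv (deriv f) ‖x‖ ^ 2) / ‖x‖ * x i := by
  have h1 : (fun j => partialD j (lagrangianPhase u) x)
      = (deriv (phaseProfile n f) ‖x‖ / ‖x‖) • (x : Fin n → ℝ) := by
    ext j
    exact partialD_comp_norm (ne_zero_of_mem_puncturedBall hx)
      ((contDiffOn_phaseProfile hf).hasDerivAt_Ioo (norm_mem_Ioo hx))
      (eventuallyEq_of_puncturedBall (lagrangianPhase_radial hradial hf) hx) j
  have h2 : graphGradient u (lagrangianPhase u) x i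
      = (graphMetric u x)⁻¹.mulVec (fun j => partialD j (lagrangianPhase u) x) i := rfl
  rw [h2, h1, graphMetric_radial hradial hf hx, axialMatrix_inv (pow_ne_zero 2 hx.1.ne')
    (dotProduct_self_eq_norm_sq x) (by positivity) (by positivity), Matrix.mulVec_smul,
    axialMatrix_mulVec (pow_ne_zero 2 hx.1.ne') (dotProduct_self_eq_norm_sq x)]
  simp only [Pi.smul_apply, smul_eq_mul]
  ring

/-- In radial form the equation `Δ_g θ = 0` says that the vector field `S(|x|) x` has divergence
zero. -/
lemma fluxProfile_ode [NeZero n] (hradial : ∀ x ∈ puncturedBall n b, u x = f ‖x‖)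
    (hf : ContDiffOn ℝ ∞ f (Ioo 0 b)) {x : Euc n} (hx : x ∈ puncturedBall n b)
    (hu : graphLaplacian u (lagrangianPhase u) x = 0) :
    ‖x‖ * deriv (fluxProfile n f) ‖x‖ + n * fluxProfile n f ‖x‖ = 0 := by
  have hdet : ∀ y ∈ puncturedBall n b, (graphMetric u y).det
      = (1 + (deriv f ‖y‖ / ‖y‖) ^ 2) ^ (n - 1) * (1 + deriv (deriv f) ‖y‖ ^ 2) := fun y hy => by
    rw [graphMetric_radial hradial hf hy, axialMatrix_det NeZero.one_le (pow_ne_zero 2 hy.1.ne')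
      (dotProduct_self_eq_norm_sq y)]
  have h1 : ∀ i, ∀ y ∈ puncturedBall n b, √(graphMetric u y).det *
      graphGradient u (lagrangianPhase u) y i = fluxProfile n f ‖y‖ * y i := fun i y hy => by
    rw [hdet y hy, graphGradient_radial hradial hf hy, fluxProfile]
    ring
  have h2 : ∀ i, partialD i (fun y => √(graphMetric u y).det *
      graphGradient u (lagrangianPhase u) y i) x
      = deriv (fluxProfile n f) ‖x‖ / ‖x‖ * (x i * x i) + fluxProfile n f ‖x‖ := fun i => by
    rw [partialD_comp_norm_mul_coord (ne_zero_of_mem_puncturedBall hx)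
      ((contDiffOn_fluxProfile hf).hasDerivAt_Ioo (norm_mem_Ioo hx)) i
      (eventuallyEq_of_puncturedBall (h1 i) hx) i, if_pos rfl, mul_one]
  have h3 : √(graphMetric u x).det ≠ 0 := by
    rw [hdet x hx]
    positivity
  rw [graphLaplacian, mul_eq_zero, one_div, inv_eq_zero, or_iff_right h3] at hu
  simp only [h2, Finset.sum_add_distrib, ← Finset.mul_sum] at hu
  have h4 : ∑ i, x i * x i = ‖x‖ ^ 2 := dotProduct_self_eq_norm_sq x
  rw [h4] at hu
  have h0 : ‖x‖ ≠ 0 := hx.1.ne'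
  simp only [Finset.sum_const, Finset.card_univ, Fintype.card_fin, nsmul_eq_mul] at hu
  rw [← hu]
  field_simp

/-- The first integral of the radial equation: the flux of `∇_g θ` through the spheres `|x| = r` of
the graph does not depend on `r`. -/
lemma exists_phaseProfile_deriv [NeZero n] (hradial : ∀ x ∈ puncturedBall n b, u x = f ‖x‖)
    (hf : ContDiffOn ℝ ∞ f (Ioo 0 b))
    (hu : ∀ x ∈ puncturedBall n b, graphLaplacian u (lagrangianPhase u) x = 0) :
    ∃ C : ℝ, ∀ r ∈ Ioo 0 b, deriv (phaseProfile n f) r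
      = C * √(1 + deriv (deriv f) r ^ 2) / √(r ^ 2 + deriv f r ^ 2) ^ (n - 1) := by
  have hode : ∀ r ∈ Ioo 0 b, r * deriv (fluxProfile n f) r + n * fluxProfile n f r = 0 :=
    fun r hr => by
    obtain ⟨y, hy⟩ := exists_norm_eq_one n
    obtain ⟨hx, hnorm⟩ := smul_mem_puncturedBall hr hy
    simpa only [hnorm] using fluxProfile_ode hradial hf hx (hu _ hx)
  obtain ⟨C, hC⟩ : ∃ C, ∀ r ∈ Ioo 0 b, r ^ n * fluxProfile n f r = C := by
    have hd : ∀ r ∈ Ioo 0 b, HasDerivAt (fun s => s ^ n * fluxProfile n f s) 0 r := fun r hr => by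
      refine ((hasDerivAt_pow n r).mul ((contDiffOn_fluxProfile hf).hasDerivAt_Ioo hr)).congr_deriv
        ?_
      have hn : r ^ n = r ^ (n - 1) * r := by
        rw [← pow_succ, Nat.sub_add_cancel NeZero.one_le]
      rw [hn]
      linear_combination r ^ (n - 1) * hode r hr
    exact isOpen_Ioo.exists_is_const_of_deriv_eq_zero isPreconnected_Ioo
      (fun r hr => (hd r hr).differentiableAt.differentiableWithinAt) fun r hr => (hd r hr).deriv
  refine ⟨C, fun r hr => ?_⟩
  have hr0 : 0 < r := hr.1
  have hρ : √(r ^ 2 + deriv f r ^ 2) = r * √(1 + (deriv f r / r) ^ 2) := by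
    rw [show r ^ 2 + deriv f r ^ 2 = r ^ 2 * (1 + (deriv f r / r) ^ 2) by field_simp,
      Real.sqrt_mul (by positivity), Real.sqrt_sq hr0.le]
  have hpow : √((1 + (deriv f r / r) ^ 2) ^ (n - 1)) = √(1 + (deriv f r / r) ^ 2) ^ (n - 1) := by
    rw [Real.sqrt_eq_iff_mul_self_eq (by positivity) (by positivity), ← mul_pow,
      Real.mul_self_sqrt (by positivity)]
  have hn : r ^ n = r ^ (n - 1) * r := by
    rw [← pow_succ, Nat.sub_add_cancel NeZero.one_le]
  rw [← hC r hr, fluxProfile, hρ, Real.sqrt_mul (by positivity), hpow, mul_pow, hn]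
  have hm : √(1 + deriv (deriv f) r ^ 2) ^ 2 = 1 + deriv (deriv f) r ^ 2 :=
    Real.sq_sqrt (by positivity)
  have h1 : 0 < √(1 + deriv (deriv f) r ^ 2) := by positivity
  have h2 : 0 < √(1 + (deriv f r / r) ^ 2) := by positivity
  field_simp
  rw [hm]

end reduction

/-! ### Profiles with vanishing slope at the origin -/

section rigidity
variable {n : ℕ} {b : ℝ} {f : ℝ → ℝ}

lemma abs_phaseProfile_le (n : ℕ) (f : ℝ → ℝ) (r : ℝ) :
    |phaseProfile n f r| ≤ Real.pi / 2 + |(n : ℝ) - 1| * (Real.pi / 2) := by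
  have h : ∀ x, |Real.arctan x| ≤ Real.pi / 2 := fun x =>
    abs_le.2 ⟨(Real.neg_pi_div_two_lt_arctan x).le, (Real.arctan_lt_pi_div_two x).le⟩
  refine (abs_add_le _ _).trans (add_le_add (h _) ?_)
  rw [abs_mul]
  exact mul_le_mul_of_nonneg_left (h _) (abs_nonneg _)

/-- If the profile curve `(r, f'(r))` runs into the origin, then the flux `C` vanishes. Along the
curve the phase varies at the rate `C ρ¹⁻ⁿ` per unit of arclength, where `ρ` is the distance to the
origin, which is at least `|C|` times the rate of `log ρ` once `ρ ≤ 1`; but the phase is bounded,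
while `log ρ` is not. -/
lemma flux_eq_zero (hn : 2 ≤ n) (hb : 0 < b) (hf : ContDiffOn ℝ ∞ f (Ioo 0 b)) {C : ℝ}
    (hC : ∀ r ∈ Ioo 0 b, deriv (phaseProfile n f) r
      = C * √(1 + deriv (deriv f) r ^ 2) / √(r ^ 2 + deriv f r ^ 2) ^ (n - 1))
    (hlim : Tendsto (deriv f) (𝓝[>] 0) (𝓝 0)) : C = 0 := by
  by_contra hC0
  have hρ0 : Tendsto (fun r => r ^ 2 + deriv f r ^ 2) (𝓝[>] 0) (𝓝 0) := by
    have h : Tendsto (fun r : ℝ => r) (𝓝[>] 0) (𝓝 0) := tendsto_id.mono_left nhdsWithin_le_nhds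
    simpa using (h.pow 2).add (hlim.pow 2)
  have hpos : ∀ r ∈ Ioo 0 b, 0 < r ^ 2 + deriv f r ^ 2 := fun r hr => by
    have := hr.1
    positivity
  obtain ⟨δ, hδ0, hδ⟩ : ∃ δ, 0 < δ ∧ ∀ r ∈ Ioo 0 δ, r ∈ Ioo 0 b ∧ r ^ 2 + deriv f r ^ 2 ≤ 1 := by
    have h := (hρ0.eventually (ge_mem_nhds one_pos)).and (Ioo_mem_nhdsGT hb)
    obtain ⟨δ, hδ0, hδ⟩ := mem_nhdsGT_iff_exists_Ioo_subset.1 h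
    exact ⟨δ, hδ0, fun r hr => ⟨(hδ hr).2, (hδ hr).1⟩⟩
  set G : ℝ → ℝ := fun r => 2 * C * phaseProfile n f r - C ^ 2 * Real.log (r ^ 2 + deriv f r ^ 2)
    with hG
  have hmono : MonotoneOn G (Ioo 0 δ) := by
    have hd : ∀ r ∈ Ioo 0 δ, HasDerivAt G (2 * C * deriv (phaseProfile n f) r
        - C ^ 2 * ((2 * r + 2 * deriv f r * deriv (deriv f) r) / (r ^ 2 + deriv f r ^ 2))) r :=
      fun r hr => by
      have h1 := (hasDerivAt_pow 2 r).add ((hf.deriv_Ioo.hasDerivAt_Ioo (hδ r hr).1).pow 2)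
      simp only [Nat.cast_ofNat, Nat.add_one_sub_one, pow_one] at h1
      exact (((contDiffOn_phaseProfile hf).hasDerivAt_Ioo (hδ r hr).1).const_mul (2 * C)).sub
        ((h1.log (hpos r (hδ r hr).1).ne').const_mul (C ^ 2))
    refine monotoneOn_of_deriv_nonneg (convex_Ioo 0 δ)
      (fun r hr => (hd r hr).continuousAt.continuousWithinAt)
      (fun r hr => (hd r (interior_subset hr)).differentiableAt.differentiableWithinAt)
      fun r hr => ?_
    have hr := interior_subset hr
    obtain ⟨hrb, hr1⟩ := hδ r hr
    have hp := hpos r hrb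
    rw [(hd r hr).deriv, hC r hrb]
    set ρ := √(r ^ 2 + deriv f r ^ 2) with hρ
    set w := √(1 + deriv (deriv f) r ^ 2) with hw
    have hρ2 : ρ ^ 2 = r ^ 2 + deriv f r ^ 2 := Real.sq_sqrt hp.le
    have hw2 : w ^ 2 = 1 + deriv (deriv f) r ^ 2 := Real.sq_sqrt (by positivity)
    have hρpos : 0 < ρ := Real.sqrt_pos.2 hp
    have hρ1 : ρ ≤ 1 := Real.sqrt_le_one.2 hr1
    have hw0 : 0 ≤ w := Real.sqrt_nonneg _
    have hcs : r + deriv f r * deriv (deriv f) r ≤ ρ * w := by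
      refine le_of_abs_le (abs_le_of_sq_le_sq ?_ (by positivity))
      rw [mul_pow, hρ2, hw2]
      nlinarith [sq_nonneg (r * deriv (deriv f) r - deriv f r)]
    have hpow : ρ ^ (n - 1) ≤ ρ := pow_le_of_le_one hρpos.le hρ1 (by omega)
    have key : (r + deriv f r * deriv (deriv f) r) / ρ ^ 2 ≤ w / ρ ^ (n - 1) :=
      calc (r + deriv f r * deriv (deriv f) r) / ρ ^ 2 ≤ (ρ * w) / ρ ^ 2 := by gcongr
        _ = w / ρ := by field_simp
        _ ≤ w / ρ ^ (n - 1) := by gcongr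
    rw [← hρ2]
    have : 0 ≤ C ^ 2 * (w / ρ ^ (n - 1) - (r + deriv f r * deriv (deriv f) r) / ρ ^ 2) :=
      mul_nonneg (sq_nonneg C) (sub_nonneg.2 key)
    calc (0 : ℝ) ≤ 2 * (C ^ 2 * (w / ρ ^ (n - 1)
          - (r + deriv f r * deriv (deriv f) r) / ρ ^ 2)) := by linarith
      _ = _ := by ring
  have hlog : Tendsto (fun r => Real.log (r ^ 2 + deriv f r ^ 2)) (𝓝[>] 0) atBot := by
    refine Real.tendsto_log_nhdsGT_zero.comp (tendsto_nhdsWithin_iff.2 ⟨hρ0, ?_⟩)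
    filter_upwards [Ioo_mem_nhdsGT hb] with r hr using hpos r hr
  set M := Real.pi / 2 + |(n : ℝ) - 1| * (Real.pi / 2)
  have hr1 : δ / 2 ∈ Ioo 0 δ := ⟨by linarith, by linarith⟩
  obtain ⟨r, hlt, hr⟩ := ((hlog.eventually_lt_atBot (-(2 * |C| * M + G (δ / 2)) / C ^ 2)).and
    (Ioo_mem_nhdsGT hr1.1)).exists
  have h1 : G r ≤ G (δ / 2) := hmono ⟨hr.1, hr.2.trans hr1.2⟩ hr1 hr.2.le
  have h2 : -(|C| * M) ≤ C * phaseProfile n f r := by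
    have h3 : |C * phaseProfile n f r| ≤ |C| * M := by
      rw [abs_mul]
      exact mul_le_mul_of_nonneg_left (abs_phaseProfile_le n f r) (abs_nonneg C)
    exact (abs_le.1 h3).1
  rw [lt_div_iff₀ (by positivity)] at hlt
  have h4 : G r = 2 * C * phaseProfile n f r - C ^ 2 * Real.log (r ^ 2 + deriv f r ^ 2) := rfl
  linarith

lemma one_add_mul_I_eq_sqrt_mul_exp (x : ℝ) :
    (1 + x * Complex.I : ℂ) = (√(1 + x ^ 2) : ℝ) * Complex.exp (Real.arctan x * Complex.I) := by
  have h : √(1 + x ^ 2) ≠ 0 := by positivity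
  rw [Complex.exp_mul_I, ← Complex.ofReal_cos, ← Complex.ofReal_sin, Real.cos_arctan,
    Real.sin_arctan]
  apply Complex.ext
  · simp [h]
  · simp
    field_simp

/-- A special Lagrangian profile whose slope vanishes at the origin is a parabola: if the phase is
the constant `Θ₀`, then `Im (e^{-iΘ₀} (r + i f'(r))ⁿ)` is constant, hence zero, and this pins
`f'(r) / r` down to a discrete set. -/
lemma deriv_eq_mul_of_phase_const (hn : 2 ≤ n) (hb : 0 < b) (hf : ContDiffOn ℝ ∞ f (Ioo 0 b))
    (hΘ : ∀ r ∈ Ioo 0 b, deriv (phaseProfile n f) r = 0)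
    (hlim : Tendsto (deriv f) (𝓝[>] 0) (𝓝 0)) : ∃ k, ∀ r ∈ Ioo 0 b, deriv f r = k * r := by
  obtain ⟨Θ₀, hΘ₀⟩ := isOpen_Ioo.exists_is_const_of_deriv_eq_zero isPreconnected_Ioo
    (fun r hr => ((contDiffOn_phaseProfile hf).hasDerivAt_Ioo
      hr).differentiableAt.differentiableWithinAt) hΘ
  have hpolar : ∀ r ∈ Ioo 0 b, (r + deriv f r * Complex.I : ℂ) = (r * √(1 + (deriv f r / r) ^ 2) : ℝ)
      * Complex.exp (Real.arctan (deriv f r / r) * Complex.I) := fun r hr => by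
    have h := one_add_mul_I_eq_sqrt_mul_exp (deriv f r / r)
    have hr0 : (r : ℂ) ≠ 0 := Complex.ofReal_ne_zero.2 hr.1.ne'
    rw [Complex.ofReal_mul, mul_assoc, ← h]
    push_cast
    field_simp
  set Z : ℝ → ℂ := fun r => (r + deriv f r * Complex.I) ^ n * Complex.exp (-(Θ₀ * Complex.I))
    with hZ
  have hZim : ∀ r ∈ Ioo 0 b, (Z r).im = 0 := by
    have hd : ∀ r ∈ Ioo 0 b, HasDerivAt (fun s => (Z s).im) 0 r := fun r hr => by
      have h1 : HasDerivAt (fun s : ℝ => (s + deriv f s * Complex.I : ℂ))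
          (1 + deriv (deriv f) r * Complex.I) r :=
        (hasDerivAt_id r).ofReal_comp.add
          ((hf.deriv_Ioo.hasDerivAt_Ioo hr).ofReal_comp.mul_const Complex.I)
      have h2 : HasDerivAt Z _ r := (h1.pow n).mul_const (Complex.exp (-(Θ₀ * Complex.I)))
      have h3 : HasDerivAt (fun s => (Z s).im) _ r :=
        Complex.imCLM.hasFDerivAt.comp_hasDerivAt r h2
      refine h3.congr_deriv ?_
      have hph : (n - 1 : ℕ) * Real.arctan (deriv f r / r) + Real.arctan (deriv (deriv f) r)
          = Θ₀ := by
        rw [← hΘ₀ r hr, phaseProfile, Nat.cast_sub (by omega)]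
        push_cast
        ring
      have h4 : (n : ℂ) * (r + deriv f r * Complex.I) ^ (n - 1)
          * (1 + deriv (deriv f) r * Complex.I) * Complex.exp (-(Θ₀ * Complex.I))
          = ((n * (r * √(1 + (deriv f r / r) ^ 2)) ^ (n - 1) * √(1 + deriv (deriv f) r ^ 2) : ℝ)
            : ℂ) := by
        have h5 : Complex.exp (Real.arctan (deriv f r / r) * Complex.I) ^ (n - 1)
            * Complex.exp (Real.arctan (deriv (deriv f) r) * Complex.I)
            * Complex.exp (-(Θ₀ * Complex.I)) = 1 := by
          rw [← Complex.exp_nat_mul, ← Complex.exp_add, ← Complex.exp_add, ← hph,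
            ← Complex.exp_zero]
          congr 1
          push_cast
          ring
        rw [hpolar r hr, one_add_mul_I_eq_sqrt_mul_exp, mul_pow]
        simp only [Complex.ofReal_mul, Complex.ofReal_pow, Complex.ofReal_natCast]
        linear_combination ((n : ℂ) * (r * (√(1 + (deriv f r / r) ^ 2) : ℝ)) ^ (n - 1)
          * (√(1 + deriv (deriv f) r ^ 2) : ℝ)) * h5
      rw [Complex.imCLM_apply, h4, Complex.ofReal_im]
    obtain ⟨K, hK⟩ := isOpen_Ioo.exists_is_const_of_deriv_eq_zero isPreconnected_Ioo
      (fun r hr => (hd r hr).differentiableAt.differentiableWithinAt) fun r hr => (hd r hr).deriv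
    have hZ0 : Tendsto (fun r => (Z r).im) (𝓝[>] 0) (𝓝 0) := by
      have h1 : Tendsto (fun r : ℝ => r) (𝓝[>] 0) (𝓝 0) := tendsto_id.mono_left nhdsWithin_le_nhds
      have h2 : Tendsto (fun r : ℝ => (r + deriv f r * Complex.I : ℂ)) (𝓝[>] 0)
          (𝓝 ((0 : ℝ) + (0 : ℝ) * Complex.I)) :=
        ((Complex.continuous_ofReal.tendsto 0).comp h1).add
          (((Complex.continuous_ofReal.tendsto 0).comp hlim).mul_const Complex.I)
      have h3 : Tendsto Z (𝓝[>] 0) _ := (h2.pow n).mul_const (Complex.exp (-(Θ₀ * Complex.I)))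
      have h4 := (Complex.continuous_im.tendsto _).comp h3
      simpa [zero_pow (show n ≠ 0 by omega), Function.comp_def] using h4
    have hK0 : K = 0 := tendsto_nhds_unique (tendsto_const_nhds.congr'
      (eventually_of_mem (Ioo_mem_nhdsGT hb) fun r hr => (hK r hr).symm)) hZ0
    exact fun r hr => (hK r hr).trans hK0
  set h : ℝ → ℝ := fun r => n * Real.arctan (deriv f r / r) - Θ₀ with hh
  have hsin : ∀ r ∈ Ioo 0 b, Real.sin (h r) = 0 := fun r hr => by
    have h1 : Z r = ((r * √(1 + (deriv f r / r) ^ 2)) ^ n : ℝ) * Complex.exp (h r * Complex.I) := by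
      rw [hZ, hh]
      simp only
      rw [hpolar r hr, mul_pow, ← Complex.exp_nat_mul, mul_assoc, ← Complex.exp_add]
      push_cast
      ring_nf
    have h2 := hZim r hr
    rw [h1, Complex.im_ofReal_mul, Complex.exp_ofReal_mul_I_im] at h2
    refine (mul_eq_zero.1 h2).resolve_left ?_
    have := hr.1
    positivity
  have hψ : ContDiffOn ℝ ∞ (fun r => Real.arctan (deriv f r / r)) (Ioo 0 b) :=
    Real.contDiff_arctan.comp_contDiffOn (contDiffOn_deriv_div hf)
  have hψ' : ∀ r ∈ Ioo 0 b, deriv (fun r => Real.arctan (deriv f r / r)) r = 0 := fun r hr => by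
    -- `sin h` vanishes identically, so `cos h * h'` does; and `cos h ≠ 0` where `sin h = 0`.
    have h1 := (((hψ.hasDerivAt_Ioo hr).const_mul (n : ℝ)).sub_const Θ₀).sin
    have h0 : (fun s => Real.sin (h s)) =ᶠ[𝓝 r] fun _ => 0 :=
      eventually_of_mem (isOpen_Ioo.mem_nhds hr) hsin
    have h2 := h1.deriv.symm.trans h0.deriv_eq
    have h3 : Real.cos (h r) ≠ 0 := fun h0 => by
      have := Real.sin_sq_add_cos_sq (h r)
      rw [hsin r hr, h0] at this
      norm_num at this
    rw [deriv_const] at h2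
    refine (mul_eq_zero.1 ((mul_eq_zero.1 h2).resolve_left h3)).resolve_left ?_
    exact Nat.cast_ne_zero.2 (by omega)
  obtain ⟨ψ₀, hψ₀⟩ := isOpen_Ioo.exists_is_const_of_deriv_eq_zero isPreconnected_Ioo
    (fun r hr => (hψ.hasDerivAt_Ioo hr).differentiableAt.differentiableWithinAt) hψ'
  refine ⟨Real.tan ψ₀, fun r hr => ?_⟩
  have hr0 : r ≠ 0 := hr.1.ne'
  rw [← hψ₀ r hr, Real.tan_arctan]
  field_simp

lemma eq_quadratic_of_deriv_eq_mul (hf : ContDiffOn ℝ ∞ f (Ioo 0 b)) {k : ℝ}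
    (hk : ∀ r ∈ Ioo 0 b, deriv f r = k * r) : ∃ a, ∀ r ∈ Ioo 0 b, f r = a + k / 2 * r ^ 2 := by
  have hd : ∀ r ∈ Ioo 0 b, HasDerivAt (fun s => f s - k / 2 * s ^ 2) 0 r := fun r hr => by
    refine ((hf.hasDerivAt_Ioo hr).sub ((hasDerivAt_pow 2 r).const_mul (k / 2))).congr_deriv ?_
    rw [hk r hr]
    push_cast
    ring
  obtain ⟨a, ha⟩ := isOpen_Ioo.exists_is_const_of_deriv_eq_zero isPreconnected_Ioo
    (fun r hr => (hd r hr).differentiableAt.differentiableWithinAt) fun r hr => (hd r hr).deriv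
  exact ⟨a, fun r hr => by linarith [ha r hr]⟩

end rigidity

/-! ### Smoothness of trajectories up to an endpoint -/

lemma hasDerivWithinAt_Ici_of_trajectory {E : Type*} [NormedAddCommGroup E] [NormedSpace ℝ E]
    {X : E → E} {U : Set E} {γ : ℝ → E} (hX : ContinuousOn X U) (hU : IsOpen U)
    (hγ : ContinuousOn γ (Ici 0)) (hmem : MapsTo γ (Ici 0) U)
    (hode : ∀ t > 0, HasDerivAt γ (X (γ t)) t) :
    ∀ t ∈ Ici (0 : ℝ), HasDerivWithinAt γ (X (γ t)) (Ici 0) t := by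
  intro t ht
  rcases eq_or_lt_of_le (mem_Ici.1 ht) with h | h
  · subst h
    have h0 : ContinuousWithinAt γ (Ioi 0) 0 := (hγ 0 self_mem_Ici).mono Ioi_subset_Ici_self
    refine hasDerivWithinAt_Ici_of_tendsto_deriv (s := Ioi 0)
      (fun s hs => (hode s hs).differentiableAt.differentiableWithinAt) h0 self_mem_nhdsWithin ?_
    have h1 : Tendsto (fun s => X (γ s)) (𝓝[>] 0) (𝓝 (X (γ 0))) :=
      ((hX.continuousAt (hU.mem_nhds (hmem self_mem_Ici))).tendsto).comp h0
    exact h1.congr' (eventually_of_mem self_mem_nhdsWithin fun s hs => (hode s hs).deriv.symm)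
  · exact (hode t h).hasDerivWithinAt

/-- A trajectory of a smooth vector field that is continuous at the initial time is smooth up to
the initial time. -/
lemma contDiffOn_Ici_of_trajectory {E : Type*} [NormedAddCommGroup E] [NormedSpace ℝ E]
    {X : E → E} {U : Set E} {γ : ℝ → E} (hX : ContDiffOn ℝ ∞ X U) (hU : IsOpen U)
    (hγ : ContinuousOn γ (Ici 0)) (hmem : MapsTo γ (Ici 0) U)
    (hode : ∀ t > 0, HasDerivAt γ (X (γ t)) t) : ContDiffOn ℝ ∞ γ (Ici 0) := by
  have hd := hasDerivWithinAt_Ici_of_trajectory hX.continuousOn hU hγ hmem hode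
  refine contDiffOn_infty.2 fun k => ?_
  induction k with
  | zero => exact contDiffOn_zero.2 hγ
  | succ k ih =>
    rw [Nat.cast_add, Nat.cast_one, contDiffOn_succ_iff_derivWithin (uniqueDiffOn_Ici 0)]
    refine ⟨fun t ht => (hd t ht).differentiableWithinAt, fun h => ?_, ?_⟩
    · exact absurd h (by simp)
    · exact ((hX.of_le (by exact_mod_cast le_top)).comp ih hmem).congr
        fun t ht => (hd t ht).derivWithin (uniqueDiffOn_Ici 0 t ht)

/-! ### Change of time -/

/-- If `w` is continuous on `(0, b)`, integrable at `0` (as it is dominated by the derivative of a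
function with a limit there) and not integrable at `b`, then the flow of `dr/dt = 1 / w(r)`
started at `r = 0` exhausts `[0, b)` as `t` runs through `[0, ∞)`. -/
lemma exists_time_change {b δ ℓ : ℝ} {w B B' : ℝ → ℝ} (hδ : 0 < δ) (hδb : δ ≤ b)
    (hw : ContinuousOn w (Ioo 0 b)) (hpos : ∀ r ∈ Ioo 0 b, 1 / (b - r) ≤ w r)
    (hB : ∀ r ∈ Ioo 0 δ, HasDerivAt B (B' r) r) (hwB : ∀ r ∈ Ioo 0 δ, w r ≤ B' r)
    (hBlim : Tendsto B (𝓝[>] 0) (𝓝 ℓ)) :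
    ∃ R : ℝ → ℝ, R 0 = 0 ∧ StrictMonoOn R (Ici 0) ∧ R '' Ioi 0 = Ioo 0 b ∧
      ContinuousOn R (Ici 0) ∧ ∀ t > 0, HasDerivAt R (w (R t))⁻¹ t := by
  have hb : 0 < b := hδ.trans_le hδb
  have hw0 : ∀ r ∈ Ioo 0 b, 0 < w r := fun r hr =>
    (one_div_pos.2 (sub_pos.2 hr.2)).trans_le (hpos r hr)
  set A : ℝ → ℝ := fun r => ∫ s in (b / 2)..r, w s with hA
  have hmid : b / 2 ∈ Ioo 0 b := ⟨by linarith, by linarith⟩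
  have hAd : ∀ r ∈ Ioo 0 b, HasDerivAt A (w r) r := fun r hr => by
    refine intervalIntegral.integral_hasDerivAt_right ?_ ?_ ?_
    · exact (hw.mono (ordConnected_Ioo.uIcc_subset hmid hr)).intervalIntegrable
    · exact hw.stronglyMeasurableAtFilter isOpen_Ioo r hr
    · exact hw.continuousAt (isOpen_Ioo.mem_nhds hr)
  have hAcont : ContinuousOn A (Ioo 0 b) := fun r hr => (hAd r hr).continuousAt.continuousWithinAt
  have hAmono : StrictMonoOn A (Ioo 0 b) :=
    strictMonoOn_of_deriv_pos (convex_Ioo 0 b) hAcont fun r hr => by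
      rw [(hAd r (interior_subset hr)).deriv]
      exact hw0 r (interior_subset hr)
  have hbdd : BddBelow (A '' Ioo 0 b) := by
    have hanti : AntitoneOn (fun r => A r - B r) (Ioo 0 δ) := by
      have hd : ∀ r ∈ Ioo 0 δ, HasDerivAt (fun r => A r - B r) (w r - B' r) r := fun r hr =>
        (hAd r ⟨hr.1, hr.2.trans_le hδb⟩).sub (hB r hr)
      refine antitoneOn_of_deriv_nonpos (convex_Ioo 0 δ)
        (fun r hr => (hd r hr).continuousAt.continuousWithinAt)
        (fun r hr => (hd r (interior_subset hr)).differentiableAt.differentiableWithinAt)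
        fun r hr => ?_
      rw [(hd r (interior_subset hr)).deriv]
      linarith [hwB r (interior_subset hr)]
    refine ⟨A (δ / 2) - B (δ / 2) + (ℓ - 1), ?_⟩
    rintro _ ⟨r, hr, rfl⟩
    have hδ2 : δ / 2 ∈ Ioo 0 δ := ⟨by linarith, by linarith⟩
    obtain ⟨s, hs1, hs2⟩ := ((hBlim.eventually (lt_mem_nhds (sub_one_lt ℓ))).and
      (Ioo_mem_nhdsGT (lt_min hr.1 hδ2.1))).exists
    have hsδ : s < δ / 2 := hs2.2.trans_le (min_le_right _ _)
    have hsr : s < r := hs2.2.trans_le (min_le_left _ _)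
    have h1 := hanti ⟨hs2.1, hsδ.trans hδ2.2⟩ hδ2 hsδ.le
    have h2 := hAmono ⟨hs2.1, hsr.trans hr.2⟩ hr hsr
    simp only at h1
    linarith
  set T : ℝ → ℝ := fun r => A r - sInf (A '' Ioo 0 b) with hT
  have hTd : ∀ r ∈ Ioo 0 b, HasDerivAt T (w r) r := fun r hr => (hAd r hr).sub_const _
  have hTmono : StrictMonoOn T (Ioo 0 b) := fun r hr s hs h => sub_lt_sub_right (hAmono hr hs h) _
  have hTcont : ContinuousOn T (Ioo 0 b) := hAcont.sub continuousOn_const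
  have hTpos : ∀ r ∈ Ioo 0 b, 0 < T r := fun r hr => by
    have hr2 : r / 2 ∈ Ioo 0 b := ⟨by linarith [hr.1], by linarith [hr.1, hr.2]⟩
    have h1 := csInf_le hbdd (mem_image_of_mem A hr2)
    have h2 := hAmono hr2 hr (by linarith [hr.1])
    exact sub_pos.2 (h1.trans_lt h2)
  have hTsmall : ∀ t > 0, ∃ r ∈ Ioo 0 b, T r < t := fun t ht => by
    obtain ⟨_, ⟨r, hr, rfl⟩, h⟩ := exists_lt_of_csInf_lt
      ((nonempty_Ioo.2 hb).image A) (lt_add_of_pos_right (sInf (A '' Ioo 0 b)) ht)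
    exact ⟨r, hr, by simp only [hT]; linarith⟩
  have hTlarge : ∀ t, ∃ r ∈ Ioo 0 b, t < T r := fun t => by
    have hmono : MonotoneOn (fun r => T r + Real.log (b - r)) (Ioo 0 b) := by
      have hd : ∀ r ∈ Ioo 0 b, HasDerivAt (fun r => T r + Real.log (b - r))
          (w r + -1 / (b - r)) r := fun r hr =>
        (hTd r hr).add (((hasDerivAt_id r).const_sub b).log (sub_pos.2 hr.2).ne')
      refine monotoneOn_of_deriv_nonneg (convex_Ioo 0 b)
        (fun r hr => (hd r hr).continuousAt.continuousWithinAt)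
        (fun r hr => (hd r (interior_subset hr)).differentiableAt.differentiableWithinAt)
        fun r hr => ?_
      rw [(hd r (interior_subset hr)).deriv, neg_div]
      linarith [hpos r (interior_subset hr)]
    have hlog : Tendsto (fun r => Real.log (b - r)) (𝓝[<] b) atBot := by
      refine Real.tendsto_log_nhdsGT_zero.comp (tendsto_nhdsWithin_iff.2 ⟨?_, ?_⟩)
      · have h : Tendsto (fun r : ℝ => b - r) (𝓝 b) (𝓝 (b - b)) :=
          (continuous_const.sub continuous_id).tendsto b
        rw [sub_self] at h
        exact h.mono_left nhdsWithin_le_nhds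
      · filter_upwards [self_mem_nhdsWithin] with r hr using sub_pos.2 (mem_Iio.1 hr)
    obtain ⟨r, h1, h2⟩ := ((hlog.eventually_lt_atBot (T (b / 2) + Real.log (b - b / 2) - t)).and
      (Ioo_mem_nhdsLT hmid.2)).exists
    have hr : r ∈ Ioo 0 b := ⟨hmid.1.trans h2.1, h2.2⟩
    have h3 := hmono hmid hr h2.1.le
    simp only at h3
    exact ⟨r, hr, by linarith⟩
  have hTsurj : ∀ t > 0, ∃ r ∈ Ioo 0 b, T r = t := fun t ht => by
    obtain ⟨r₁, hr₁, h₁⟩ := hTsmall t ht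
    obtain ⟨r₂, hr₂, h₂⟩ := hTlarge t
    exact (isPreconnected_Ioo.image T hTcont).ordConnected.out (mem_image_of_mem T hr₁)
      (mem_image_of_mem T hr₂) ⟨h₁.le, h₂.le⟩
  choose! R₁ hR₁ hTR₁ using hTsurj
  set R : ℝ → ℝ := fun t => if 0 < t then R₁ t else 0 with hR
  have hRpos : ∀ t > 0, R t = R₁ t := fun t ht => if_pos ht
  have hR0 : R 0 = 0 := if_neg (lt_irrefl 0)
  have hRmem : ∀ t > 0, R t ∈ Ioo 0 b := fun t ht => hRpos t ht ▸ hR₁ t ht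
  have hTR : ∀ t > 0, T (R t) = t := fun t ht => by rw [hRpos t ht, hTR₁ t ht]
  have hRT : ∀ r ∈ Ioo 0 b, R (T r) = r := fun r hr =>
    hTmono.injOn (hRmem _ (hTpos r hr)) hr (hTR _ (hTpos r hr))
  have hRimage : R '' Ioi 0 = Ioo 0 b := by
    refine Subset.antisymm ?_ fun r hr => ⟨T r, hTpos r hr, hRT r hr⟩
    rintro _ ⟨t, ht, rfl⟩
    exact hRmem t ht
  have hRmono : StrictMonoOn R (Ici 0) := fun s hs t ht hst => by
    have ht0 : 0 < t := (mem_Ici.1 hs).trans_lt hst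
    rcases eq_or_lt_of_le (mem_Ici.1 hs) with h | h
    · rw [← h, hR0]
      exact (hRmem t ht0).1
    · rw [← hTmono.lt_iff_lt (hRmem s h) (hRmem t ht0), hTR s h, hTR t ht0]
      exact hst
  have hRcont : ∀ t > 0, ContinuousAt R t := fun t ht => by
    refine StrictMonoOn.continuousAt_of_image_mem_nhds (s := Ioi 0)
      (hRmono.mono Ioi_subset_Ici_self) (Ioi_mem_nhds ht) ?_
    rw [hRimage]
    exact isOpen_Ioo.mem_nhds (hRmem t ht)
  refine ⟨R, hR0, hRmono, hRimage, fun t ht => ?_, fun t ht => ?_⟩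
  · rcases eq_or_lt_of_le (mem_Ici.1 ht) with h | h
    · subst h
      refine hRmono.continuousWithinAt_right_of_exists_between self_mem_nhdsWithin fun ε hε => ?_
      rw [hR0] at hε ⊢
      have hm : min ε (b / 2) ∈ Ioo 0 b :=
        ⟨lt_min hε hmid.1, (min_le_right _ _).trans_lt hmid.2⟩
      exact ⟨T (min ε (b / 2)), (hTpos _ hm).le, by
        rw [hRT _ hm]
        exact ⟨hm.1, min_le_left _ _⟩⟩
    · exact (hRcont t h).continuousWithinAt
  · exact HasDerivAt.of_local_left_inverse (hRcont t ht) (hTd _ (hRmem t ht))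
      (hw0 _ (hRmem t ht)).ne' (eventually_of_mem (Ioi_mem_nhds ht) hTR)

/-! ### Profiles with nonzero slope at the origin -/

/-- The curvature of the profile curve `(r, f'(r))` with tangent angle `φ` at the point `(r, v)`:
the equation with flux `C` reads `dφ/ds = κ(r, v, φ)` in terms of the arclength `s`. It is smooth in
`(r, v, φ)` away from `r = v = 0`, in particular across the axis `r = 0`. -/
def profileCurvature (n : ℕ) (C r v φ : ℝ) : ℝ :=
  C / √(r ^ 2 + v ^ 2) ^ (n - 1) - (n - 1) * (r * Real.sin φ - v * Real.cos φ) / (r ^ 2 + v ^ 2)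

/-- The vector field on `(r, v, φ)`-space that follows the profile curves at speed `b - r`. This
speed makes them take infinite time to reach `r = b`. -/
def profileField (n : ℕ) (C b : ℝ) (z : ℝ × ℝ × ℝ) : ℝ × ℝ × ℝ :=
  ((b - z.1) * Real.cos z.2.2, (b - z.1) * Real.sin z.2.2,
    (b - z.1) * profileCurvature n C z.1 z.2.1 z.2.2)

lemma contDiffOn_profileField (n : ℕ) (C b : ℝ) :
    ContDiffOn ℝ ∞ (profileField n C b) {z | 0 < z.1 ^ 2 + z.2.1 ^ 2} := by
  have h1 : ContDiffOn ℝ ∞ (fun z : ℝ × ℝ × ℝ => z.1) {z | 0 < z.1 ^ 2 + z.2.1 ^ 2} :=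
    contDiff_fst.contDiffOn
  have h2 : ContDiffOn ℝ ∞ (fun z : ℝ × ℝ × ℝ => z.2.1) {z | 0 < z.1 ^ 2 + z.2.1 ^ 2} :=
    (contDiff_fst.comp contDiff_snd).contDiffOn
  have h3 : ContDiffOn ℝ ∞ (fun z : ℝ × ℝ × ℝ => z.2.2) {z | 0 < z.1 ^ 2 + z.2.1 ^ 2} :=
    (contDiff_snd.comp contDiff_snd).contDiffOn
  have hs := Real.contDiff_sin.comp_contDiffOn h3
  have hc := Real.contDiff_cos.comp_contDiffOn h3
  have hb : ContDiffOn ℝ ∞ (fun z : ℝ × ℝ × ℝ => b - z.1) {z | 0 < z.1 ^ 2 + z.2.1 ^ 2} :=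
    contDiffOn_const.sub h1
  have hρ := (h1.pow 2).add (h2.pow 2)
  refine (hb.mul hc).prodMk ((hb.mul hs).prodMk (hb.mul (ContDiffOn.sub
    (contDiffOn_const.div ((hρ.sqrt fun z hz => ne_of_gt hz).pow (n - 1)) fun z hz => ?_)
    ((contDiffOn_const.mul ((h1.mul hs).sub (h2.mul hc))).div hρ fun z hz => ne_of_gt hz))))
  exact pow_ne_zero _ (Real.sqrt_pos.2 hz).ne'

section parametrization
variable {n : ℕ} {b C c : ℝ} {f : ℝ → ℝ}

/-- In terms of `r` the tangent angle varies at the rate `κ ds/dr`. -/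
lemma hasDerivAt_arctan_deriv (hf : ContDiffOn ℝ ∞ f (Ioo 0 b)) {r : ℝ} (hr : r ∈ Ioo 0 b)
    (hC : deriv (phaseProfile n f) r
      = C * √(1 + deriv (deriv f) r ^ 2) / √(r ^ 2 + deriv f r ^ 2) ^ (n - 1)) :
    HasDerivAt (fun s => Real.arctan (deriv (deriv f) s))
      (profileCurvature n C r (deriv f r) (Real.arctan (deriv (deriv f) r))
        * √(1 + deriv (deriv f) r ^ 2)) r := by
  have h1 := (contDiffOn_phaseProfile (n := n) hf).hasDerivAt_Ioo hr
  have h2 := ((((hf.deriv_Ioo.hasDerivAt_Ioo hr).div (hasDerivAt_id r) hr.1.ne').arctan).const_mul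
    ((n : ℝ) - 1))
  have h3 := h1.sub h2
  have h4 : (fun s => Real.arctan (deriv (deriv f) s)) = phaseProfile n f
      - fun s => ((n : ℝ) - 1) * Real.arctan (deriv f s / s) := by
    ext s
    simp [phaseProfile]
  rw [h4]
  refine h3.congr_deriv ?_
  have hr0 : 0 < r := hr.1
  have hw : 0 < √(1 + deriv (deriv f) r ^ 2) := by positivity
  have hρ : 0 < √(r ^ 2 + deriv f r ^ 2) := by positivity
  have hρ2 : 0 < r ^ 2 + deriv f r ^ 2 := by positivity
  have h5 : 1 + (deriv f r / r) ^ 2 = (r ^ 2 + deriv f r ^ 2) / r ^ 2 := by field_simp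
  rw [hC, profileCurvature, Real.sin_arctan, Real.cos_arctan]
  simp only [Pi.div_apply, id_eq, h5]
  field_simp

lemma exists_profileCurvature_bound (hb : 0 < b) (hc : c ≠ 0)
    (hlim : Tendsto (deriv f) (𝓝[>] 0) (𝓝 c)) (n : ℕ) (C : ℝ) :
    ∃ K : NNReal, ∀ᶠ r in 𝓝[>] 0, ∀ φ, |profileCurvature n C r (deriv f r) φ| ≤ K := by
  have hc2 : 0 < |c| / 2 := by positivity
  set K : ℝ := |C| / (|c| / 2) ^ (n - 1) + |(n : ℝ) - 1| * (b + 2 * |c|) / (|c| / 2) ^ 2 with hK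
  have hK0 : 0 ≤ K := by positivity
  refine ⟨⟨K, hK0⟩, ?_⟩
  have h1 := hlim.abs.eventually (lt_mem_nhds (half_lt_self (abs_pos.2 hc)))
  have h2 := hlim.abs.eventually (gt_mem_nhds (show |c| < 2 * |c| by linarith [abs_pos.2 hc]))
  filter_upwards [h1, h2, Ioo_mem_nhdsGT hb] with r hr1 hr2 hr φ
  have hρ2 : (|c| / 2) ^ 2 ≤ r ^ 2 + deriv f r ^ 2 := by
    rw [← sq_abs (deriv f r)]
    nlinarith [sq_nonneg r]
  have hρ : |c| / 2 ≤ √(r ^ 2 + deriv f r ^ 2) := Real.le_sqrt_of_sq_le hρ2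
  have hnum : |r * Real.sin φ - deriv f r * Real.cos φ| ≤ b + 2 * |c| := by
    refine (abs_sub _ _).trans (add_le_add ?_ ?_)
    · rw [abs_mul, abs_of_pos hr.1]
      nlinarith [Real.abs_sin_le_one φ, hr.1, hr.2]
    · rw [abs_mul]
      nlinarith [Real.abs_cos_le_one φ, abs_nonneg (deriv f r)]
  refine (abs_sub _ _).trans (add_le_add ?_ ?_)
  · rw [abs_div, abs_of_nonneg (by positivity : 0 ≤ √(r ^ 2 + deriv f r ^ 2) ^ (n - 1))]
    gcongr
  · rw [abs_div, abs_mul, abs_of_nonneg (by positivity : 0 ≤ r ^ 2 + deriv f r ^ 2)]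
    gcongr

/-- The tangent angle of the profile curve has a limit at the axis. Since the curvature is bounded
near the end point, `sin φ` is a Lipschitz function of `r`. -/
lemma exists_tendsto_arctan_deriv (hb : 0 < b) (hf : ContDiffOn ℝ ∞ f (Ioo 0 b)) (hc : c ≠ 0)
    (hC : ∀ r ∈ Ioo 0 b, deriv (phaseProfile n f) r
      = C * √(1 + deriv (deriv f) r ^ 2) / √(r ^ 2 + deriv f r ^ 2) ^ (n - 1))
    (hlim : Tendsto (deriv f) (𝓝[>] 0) (𝓝 c)) :
    ∃ φ₀, Tendsto (fun r => Real.arctan (deriv (deriv f) r)) (𝓝[>] 0) (𝓝 φ₀) := by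
  obtain ⟨K, hK⟩ := exists_profileCurvature_bound hb hc hlim n C
  obtain ⟨δ, hδ0, hδ⟩ := mem_nhdsGT_iff_exists_Ioo_subset.1 (hK.and (Ioo_mem_nhdsGT hb))
  have hd : ∀ r ∈ Ioo 0 δ, HasDerivAt (fun s => Real.sin (Real.arctan (deriv (deriv f) s)))
      (profileCurvature n C r (deriv f r) (Real.arctan (deriv (deriv f) r))) r := fun r hr => by
    have hrb := (hδ hr).2
    refine (hasDerivAt_arctan_deriv hf hrb (hC r hrb)).sin.congr_deriv ?_
    have hw : 0 < √(1 + deriv (deriv f) r ^ 2) := by positivity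
    rw [Real.cos_arctan]
    field_simp
  have hlip : LipschitzOnWith K (fun s => Real.sin (Real.arctan (deriv (deriv f) s))) (Ioo 0 δ) := by
    refine (convex_Ioo 0 δ).lipschitzOnWith_of_nnnorm_hasDerivWithin_le
      (fun r hr => (hd r hr).hasDerivWithinAt) fun r hr => ?_
    have h := (hδ hr).1 (Real.arctan (deriv (deriv f) r))
    exact_mod_cast h
  obtain ⟨g, hg, hgeq⟩ := hlip.extend_real
  have h1 : Tendsto (fun s => Real.sin (Real.arctan (deriv (deriv f) s))) (𝓝[>] 0) (𝓝 (g 0)) :=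
    ((hg.continuous.tendsto 0).mono_left nhdsWithin_le_nhds).congr'
      (eventually_of_mem (Ioo_mem_nhdsGT hδ0) fun r hr => (hgeq hr).symm)
  refine ⟨Real.arcsin (g 0), ((Real.continuous_arcsin.tendsto _).comp h1).congr fun r => ?_⟩
  exact Real.arcsin_sin (Real.neg_pi_div_two_lt_arctan _).le (Real.arctan_lt_pi_div_two _).le

/-- For `h = f''` this bounds the arclength element near the axis by the derivative of
`3 r + ε f'(r)`, where `ε = ±1`: since the tangent angle converges, `f''` is bounded from below or from
above there. -/
lemma exists_sqrt_le_of_tendsto_arctan {h : ℝ → ℝ} {φ₀ : ℝ}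
    (hφ : Tendsto (fun r => Real.arctan (h r)) (𝓝[>] 0) (𝓝 φ₀)) :
    ∃ ε : ℝ, ∀ᶠ r in 𝓝[>] 0, √(1 + h r ^ 2) ≤ 3 + ε * h r := by
  have hpi : 0 < Real.pi / 4 := by positivity
  have hle : ∀ x : ℝ, √(1 + x ^ 2) ≤ 1 + |x| := fun x => by
    refine Real.sqrt_le_iff.2 ⟨by positivity, ?_⟩
    nlinarith [sq_abs x, abs_nonneg x]
  rcases le_or_gt 0 φ₀ with h0 | h0
  · refine ⟨1, ?_⟩
    filter_upwards [hφ.eventually (lt_mem_nhds (show -(Real.pi / 4) < φ₀ by linarith))] with r hr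
    rw [← Real.arctan_one, ← Real.arctan_neg, Real.arctan_strictMono.lt_iff_lt] at hr
    refine (hle _).trans ?_
    rcases abs_cases (h r) with h1 | h1 <;> linarith
  · refine ⟨-1, ?_⟩
    filter_upwards [hφ.eventually (gt_mem_nhds (show φ₀ < Real.pi / 4 by linarith))] with r hr
    rw [← Real.arctan_one, Real.arctan_strictMono.lt_iff_lt] at hr
    refine (hle _).trans ?_
    rcases abs_cases (h r) with h1 | h1 <;> linarith

/-- The profile curve `(r, f'(r))`, completed by its end point `(0, c)`, `c ≠ 0`, has a regular
parametrization by `[0, ∞)` that is smooth up to the boundary. -/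
lemma exists_profile_parametrization (hb : 0 < b) (hf : ContDiffOn ℝ ∞ f (Ioo 0 b)) (hc : c ≠ 0)
    (hC : ∀ r ∈ Ioo 0 b, deriv (phaseProfile n f) r
      = C * √(1 + deriv (deriv f) r ^ 2) / √(r ^ 2 + deriv f r ^ 2) ^ (n - 1))
    (hlim : Tendsto (deriv f) (𝓝[>] 0) (𝓝 c)) :
    ∃ R V R' V' : ℝ → ℝ, R 0 = 0 ∧ V 0 = c ∧ StrictMonoOn R (Ici 0) ∧ R '' Ioi 0 = Ioo 0 b ∧
      (∀ t > 0, V t = deriv f (R t)) ∧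
      ContDiffOn ℝ ∞ R (Ici 0) ∧ ContDiffOn ℝ ∞ V (Ici 0) ∧
      (∀ t ∈ Ici 0, HasDerivWithinAt R (R' t) (Ici 0) t) ∧
      (∀ t ∈ Ici 0, HasDerivWithinAt V (V' t) (Ici 0) t) ∧
      ∀ t ∈ Ici 0, R' t ≠ 0 ∨ V' t ≠ 0 := by
  obtain ⟨φ₀, hφ⟩ := exists_tendsto_arctan_deriv hb hf hc hC hlim
  obtain ⟨ε, hε⟩ := exists_sqrt_le_of_tendsto_arctan hφ
  obtain ⟨δ, hδ0, hδ⟩ := mem_nhdsGT_iff_exists_Ioo_subset.1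
    (hε.and (Ioo_mem_nhdsGT (half_pos hb)))
  have hδb : ∀ r ∈ Ioo 0 (min δ b), r ∈ Ioo 0 b := fun r hr =>
    ⟨hr.1, hr.2.trans_le (min_le_right _ _)⟩
  have hvlim : Tendsto (fun r => 2 / b * (3 * r + ε * deriv f r)) (𝓝[>] 0)
      (𝓝 (2 / b * (3 * 0 + ε * c))) := by
    have h : Tendsto (fun r : ℝ => r) (𝓝[>] 0) (𝓝 0) := tendsto_id.mono_left nhdsWithin_le_nhds
    exact ((h.const_mul 3).add (hlim.const_mul ε)).const_mul _
  obtain ⟨R, hR0, hRmono, hRimage, hRcont, hRd⟩ := exists_time_change (b := b) (δ := min δ b)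
    (w := fun r => √(1 + deriv (deriv f) r ^ 2) / (b - r))
    (B := fun r => 2 / b * (3 * r + ε * deriv f r))
    (B' := fun r => 2 / b * (3 * 1 + ε * deriv (deriv f) r)) (lt_min hδ0 hb) (min_le_right _ _)
    (by
      refine ContinuousOn.div ?_ (continuousOn_const.sub continuousOn_id)
        fun r hr => (sub_pos.2 hr.2).ne'
      exact (continuousOn_const.add (hf.deriv_Ioo.deriv_Ioo.continuousOn.pow 2)).sqrt)
    (fun r hr => by
      have h1 : 1 ≤ √(1 + deriv (deriv f) r ^ 2) :=
        Real.one_le_sqrt.2 (by linarith [sq_nonneg (deriv (deriv f) r)])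
      exact div_le_div_of_nonneg_right h1 (sub_pos.2 hr.2).le)
    (fun r hr => ((((hasDerivAt_id r).const_mul 3).add
      ((hf.deriv_Ioo.hasDerivAt_Ioo (hδb r hr)).const_mul ε)).const_mul (2 / b)))
    (fun r hr => by
      obtain ⟨h1, h2⟩ := hδ ⟨hr.1, hr.2.trans_le (min_le_left _ _)⟩
      have h3 : 0 < b - r := by linarith [h2.2]
      have h4 : 1 / (b - r) ≤ 2 / b := by
        rw [div_le_div_iff₀ h3 hb]
        linarith [h2.2]
      calc √(1 + deriv (deriv f) r ^ 2) / (b - r)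
          = 1 / (b - r) * √(1 + deriv (deriv f) r ^ 2) := by ring
        _ ≤ 2 / b * (3 * 1 + ε * deriv (deriv f) r) := by
          rw [mul_one]
          exact mul_le_mul h4 h1 (Real.sqrt_nonneg _) (by positivity))
    hvlim
  have hRmem : ∀ t > 0, R t ∈ Ioo 0 b := fun t ht => hRimage ▸ mem_image_of_mem R ht
  have hRlim : Tendsto R (𝓝[>] 0) (𝓝[>] 0) := by
    refine tendsto_nhdsWithin_iff.2 ⟨?_, eventually_of_mem self_mem_nhdsWithin
      fun t ht => (hRmem t ht).1⟩
    have h := (hRcont 0 self_mem_Ici).mono Ioi_subset_Ici_self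
    rwa [ContinuousWithinAt, hR0] at h
  -- `h ∘ R` extends continuously by the limit of `h` at `0`.
  have hext : ∀ (h : ℝ → ℝ) (ℓ : ℝ), ContinuousOn h (Ioo 0 b) → Tendsto h (𝓝[>] 0) (𝓝 ℓ) →
      ContinuousOn (fun t => if 0 < t then h (R t) else ℓ) (Ici 0) := fun h ℓ hcont hℓ t ht => by
    rcases eq_or_lt_of_le (mem_Ici.1 ht) with h0 | h0
    · subst h0
      refine continuousWithinAt_Ioi_iff_Ici.1 ?_
      rw [ContinuousWithinAt, if_neg (lt_irrefl 0)]
      exact (hℓ.comp hRlim).congr' (eventually_of_mem self_mem_nhdsWithin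
        fun t ht => (if_pos ht).symm)
    · have h1 : ContinuousAt (fun t => h (R t)) t :=
        ContinuousAt.comp (hcont.continuousAt (isOpen_Ioo.mem_nhds (hRmem t h0)))
          (hRd t h0).continuousAt
      exact (h1.congr (eventually_of_mem (Ioi_mem_nhds h0)
        fun t ht => (if_pos ht).symm)).continuousWithinAt
  set V : ℝ → ℝ := fun t => if 0 < t then deriv f (R t) else c with hV
  set Φ : ℝ → ℝ := fun t => if 0 < t then Real.arctan (deriv (deriv f) (R t)) else φ₀ with hΦ
  have hVpos : ∀ t > 0, V t = deriv f (R t) := fun t ht => if_pos ht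
  have hΦpos : ∀ t > 0, Φ t = Real.arctan (deriv (deriv f) (R t)) := fun t ht => if_pos ht
  have hV0 : V 0 = c := if_neg (lt_irrefl 0)
  set γ : ℝ → ℝ × ℝ × ℝ := fun t => (R t, V t, Φ t) with hγ
  have hγcont : ContinuousOn γ (Ici 0) :=
    hRcont.prodMk ((hext _ _ hf.deriv_Ioo.continuousOn hlim).prodMk
      (hext _ _ (Real.continuous_arctan.comp_continuousOn hf.deriv_Ioo.deriv_Ioo.continuousOn) hφ))
  have hγmem : MapsTo γ (Ici 0) {z | 0 < z.1 ^ 2 + z.2.1 ^ 2} := fun t ht => by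
    change 0 < R t ^ 2 + V t ^ 2
    rcases eq_or_lt_of_le (mem_Ici.1 ht) with h | h
    · rw [← h, hV0]
      positivity
    · have := (hRmem t h).1
      positivity
  have hγode : ∀ t > 0, HasDerivAt γ (profileField n C b (γ t)) t := fun t ht => by
    have hr := hRmem t ht
    have hw : 0 < √(1 + deriv (deriv f) (R t) ^ 2) := by positivity
    have hbr : 0 < b - R t := sub_pos.2 hr.2
    have h1 := hRd t ht
    have h2 := ((hf.deriv_Ioo.hasDerivAt_Ioo hr).comp t h1).congr_of_eventuallyEq
      (eventually_of_mem (Ioi_mem_nhds ht) hVpos)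
    have h3 := ((hasDerivAt_arctan_deriv hf hr (hC _ hr)).comp t h1).congr_of_eventuallyEq
      (eventually_of_mem (Ioi_mem_nhds ht) hΦpos)
    refine (h1.prodMk (h2.prodMk h3)).congr_deriv ?_
    simp only [profileField, hγ, hVpos t ht, hΦpos t ht, Real.cos_arctan, Real.sin_arctan]
    refine Prod.ext ?_ (Prod.ext ?_ ?_)
    · simp only
      field_simp
    · simp only
      field_simp
    · simp only
      field_simp
  have hopen : IsOpen {z : ℝ × ℝ × ℝ | 0 < z.1 ^ 2 + z.2.1 ^ 2} :=
    isOpen_lt continuous_const (by fun_prop)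
  have hsm := contDiffOn_Ici_of_trajectory (contDiffOn_profileField n C b) hopen hγcont hγmem hγode
  have hd := hasDerivWithinAt_Ici_of_trajectory (contDiffOn_profileField n C b).continuousOn hopen
    hγcont hγmem hγode
  refine ⟨R, V, fun t => (b - R t) * Real.cos (Φ t), fun t => (b - R t) * Real.sin (Φ t), hR0, hV0,
    hRmono, hRimage, hVpos, contDiff_fst.comp_contDiffOn hsm,
    (contDiff_fst.comp contDiff_snd).comp_contDiffOn hsm,
    fun t ht => (ContinuousLinearMap.fst ℝ ℝ (ℝ × ℝ)).hasFDerivAt.comp_hasDerivWithinAt t (hd t ht),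
    fun t ht => ((ContinuousLinearMap.fst ℝ ℝ ℝ).comp
      (ContinuousLinearMap.snd ℝ ℝ (ℝ × ℝ))).hasFDerivAt.comp_hasDerivWithinAt t (hd t ht),
    fun t ht => ?_⟩
  have hbr : b - R t ≠ 0 := by
    rcases eq_or_lt_of_le (mem_Ici.1 ht) with h | h
    · rw [← h, hR0, sub_zero]
      exact hb.ne'
    · exact (sub_pos.2 (hRmem t h).2).ne'
  by_contra hcon
  push Not at hcon
  have hcos := (mul_eq_zero.1 hcon.1).resolve_left hbr
  have hsin := (mul_eq_zero.1 hcon.2).resolve_left hbr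
  have := Real.sin_sq_add_cos_sq (Φ t)
  rw [hcos, hsin] at this
  norm_num at this

end parametrization

/-! ### The completed graph -/

section completion
variable {n : ℕ} {b c : ℝ} {u : Euc n → ℝ} {f : ℝ → ℝ}

lemma continuous_ambFst : Continuous fun z : Amb n => z.fst :=
  (WithLp.prodContinuousLinearEquiv 2 ℝ (Euc n) (Euc n)).continuous.fst

lemma continuous_ambSnd : Continuous fun z : Amb n => z.snd :=
  (WithLp.prodContinuousLinearEquiv 2 ℝ (Euc n) (Euc n)).continuous.snd

lemma amb_ext {z w : Amb n} (h1 : z.fst = w.fst) (h2 : z.snd = w.snd) : z = w :=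
  (WithLp.ofLp_injective 2) (Prod.ext h1 h2)

lemma smul_mem_gradientGraph (hradial : ∀ x ∈ puncturedBall n b, u x = f ‖x‖)
    (hf : ContDiffOn ℝ ∞ f (Ioo 0 b)) {r : ℝ} (hr : r ∈ Ioo 0 b) {y : Euc n} (hy : ‖y‖ = 1) :
    (WithLp.toLp 2 (r • y, deriv f r • y) : Amb n) ∈ gradientGraph u (puncturedBall n b) := by
  obtain ⟨hx, hnorm⟩ := smul_mem_puncturedBall hr hy
  refine ⟨hx, ?_⟩
  change deriv f r • y = ∇ u (r • y)
  rw [gradient_radial hradial hf hx, hnorm, smul_smul, div_mul_cancel₀ _ hr.1.ne']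

/-- The rays `(r y, f'(r) y)` of the gradient graph end at the points `(0, c y)`, which therefore
belong to the completed graph. -/
lemma mem_completedGraph_of_tendsto (hb : 0 < b)
    (hradial : ∀ x ∈ puncturedBall n b, u x = f ‖x‖) (hf : ContDiffOn ℝ ∞ f (Ioo 0 b))
    (hlim : Tendsto (deriv f) (𝓝[>] 0) (𝓝 c)) {y : Euc n} (hy : ‖y‖ = 1) :
    (WithLp.toLp 2 (0, c • y) : Amb n) ∈ completedGraph u b := by
  refine ⟨?_, ?_⟩
  · have h1 : Tendsto (fun r : ℝ => r) (𝓝[>] 0) (𝓝 0) := tendsto_id.mono_left nhdsWithin_le_nhds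
    have h2 : Tendsto (fun r : ℝ => (r • y, deriv f r • y)) (𝓝[>] 0) (𝓝 ((0 : ℝ) • y, c • y)) :=
      (h1.smul_const y).prodMk_nhds (hlim.smul_const y)
    have h3 : Tendsto (fun r : ℝ => (WithLp.toLp 2 (r • y, deriv f r • y) : Amb n)) (𝓝[>] 0) _ :=
      ((WithLp.prodContinuousLinearEquiv 2 ℝ (Euc n) (Euc n)).symm.continuous.tendsto _).comp h2
    rw [zero_smul] at h3
    exact mem_closure_of_tendsto h3 (eventually_of_mem (Ioo_mem_nhdsGT hb)
      fun r hr => smul_mem_gradientGraph hradial hf hr hy)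
  · change ‖(0 : Euc n)‖ < b
    rwa [norm_zero]

lemma gradientGraph_subset_completedGraph :
    gradientGraph u (puncturedBall n b) ⊆ completedGraph u b :=
  fun _ hz => ⟨subset_closure hz, hz.1.2⟩

lemma completedGraph_eq_of_tendsto (hb : 0 < b)
    (hradial : ∀ x ∈ puncturedBall n b, u x = f ‖x‖) (hf : ContDiffOn ℝ ∞ f (Ioo 0 b))
    (hc : c ≠ 0) (hlim : Tendsto (deriv f) (𝓝[>] 0) (𝓝 c)) :
    completedGraph u b = gradientGraph u (puncturedBall n b) ∪ sphereOverOrigin n |c| := by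
  refine Subset.antisymm ?_ (union_subset gradientGraph_subset_completedGraph ?_)
  · rintro z ⟨hz, hzb⟩
    have hne : (𝓝[gradientGraph u (puncturedBall n b)] z).NeBot :=
      mem_closure_iff_nhdsWithin_neBot.1 hz
    have h1 : Tendsto (fun w : Amb n => w.fst) (𝓝[gradientGraph u (puncturedBall n b)] z)
        (𝓝 z.fst) := (continuous_ambFst.tendsto z).mono_left nhdsWithin_le_nhds
    have h2 : Tendsto (fun w : Amb n => w.snd) (𝓝[gradientGraph u (puncturedBall n b)] z)
        (𝓝 z.snd) := (continuous_ambSnd.tendsto z).mono_left nhdsWithin_le_nhds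
    by_cases h0 : z.fst = 0
    · right
      refine ⟨h0, ?_⟩
      have h3 : Tendsto (fun w : Amb n => ‖w.fst‖)
          (𝓝[gradientGraph u (puncturedBall n b)] z) (𝓝[>] 0) := by
        refine tendsto_nhdsWithin_iff.2 ⟨?_, ?_⟩
        · have h4 := h1.norm
          rwa [h0, norm_zero] at h4
        · filter_upwards [self_mem_nhdsWithin] with w hw using hw.1.1
      refine tendsto_nhds_unique (h2.norm.congr' ?_) (hlim.comp h3).abs
      filter_upwards [self_mem_nhdsWithin] with w hw
      have hw0 : 0 < ‖w.fst‖ := hw.1.1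
      rw [hw.2, gradient_radial hradial hf hw.1, norm_smul, norm_div, norm_norm,
        div_mul_cancel₀ _ hw0.ne', Real.norm_eq_abs, Function.comp_apply]
    · left
      have hzΩ : z.fst ∈ puncturedBall n b := ⟨norm_pos_iff.2 h0, hzb⟩
      refine ⟨hzΩ, tendsto_nhds_unique h2 ?_⟩
      have h3 : ContinuousAt (fun x : Euc n => (deriv f ‖x‖ / ‖x‖) • x) z.fst :=
        (ContinuousAt.comp (f := fun x : Euc n => ‖x‖) ((contDiffOn_deriv_div
          hf).continuousOn.continuousAt (isOpen_Ioo.mem_nhds (norm_mem_Ioo hzΩ)))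
          continuous_norm.continuousAt).smul continuousAt_id
      rw [gradient_radial hradial hf hzΩ]
      refine (h3.tendsto.comp h1).congr' ?_
      filter_upwards [self_mem_nhdsWithin] with w hw
      rw [hw.2, gradient_radial hradial hf hw.1, Function.comp_apply]
  · rintro z ⟨hz1, hz2⟩
    have hy : ‖c⁻¹ • z.snd‖ = 1 := by
      rw [norm_smul, hz2, norm_inv, Real.norm_eq_abs, inv_mul_cancel₀ (abs_ne_zero.2 hc)]
    have h := mem_completedGraph_of_tendsto hb hradial hf hlim hy
    rw [smul_inv_smul₀ hc] at h
    convert h using 1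
    exact amb_ext hz1 rfl

/-- The graph of `x ↦ k x` as a linear map into `ℝⁿ × ℝⁿ`. -/
def scalarGraph (n : ℕ) (k : ℝ) : Euc n →ₗ[ℝ] Amb n :=
  (WithLp.prodContinuousLinearEquiv 2 ℝ (Euc n) (Euc n)).symm.toLinearMap ∘ₗ
    (LinearMap.id.prod (k • LinearMap.id))

lemma mem_range_scalarGraph {k : ℝ} {z : Amb n} :
    z ∈ LinearMap.range (scalarGraph n k) ↔ z.snd = k • z.fst := by
  refine ⟨?_, fun h => ⟨z.fst, amb_ext rfl h.symm⟩⟩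
  rintro ⟨x, rfl⟩
  rfl

lemma isFlatDisk_completedGraph [NeZero n] (hb : 0 < b)
    (hradial : ∀ x ∈ puncturedBall n b, u x = f ‖x‖) (hf : ContDiffOn ℝ ∞ f (Ioo 0 b))
    (hlim : Tendsto (deriv f) (𝓝[>] 0) (𝓝 0)) {k : ℝ} (hk : ∀ r ∈ Ioo 0 b, deriv f r = k * r) :
    IsFlatDisk (completedGraph u b) := by
  have hgrad : ∀ x ∈ puncturedBall n b, ∇ u x = k • x := fun x hx => by
    rw [gradient_radial hradial hf hx, hk _ (norm_mem_Ioo hx), mul_div_cancel_right₀ _ hx.1.ne']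
  refine ⟨0, LinearMap.range (scalarGraph n k), √(1 + k ^ 2) * b, ?_, by positivity, ?_⟩
  · rw [LinearMap.finrank_range_of_inj, finrank_euclideanSpace_fin]
    intro x y hxy
    exact congrArg (fun z : Amb n => z.fst) hxy
  · ext z
    rw [mem_ofPred_eq, sub_zero, mem_range_scalarGraph]
    have hnorm : z.snd = k • z.fst → ‖z‖ = √(1 + k ^ 2) * ‖z.fst‖ := fun h => by
      rw [WithLp.prod_norm_eq_of_L2, h, norm_smul, mul_pow, Real.norm_eq_abs, sq_abs,
        ← one_add_mul, Real.sqrt_mul (by positivity), Real.sqrt_sq (norm_nonneg _)]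
    have hlt : z.snd = k • z.fst → (‖z‖ < √(1 + k ^ 2) * b ↔ ‖z.fst‖ < b) := fun h => by
      rw [hnorm h]
      exact mul_lt_mul_iff_right₀ (by positivity)
    constructor
    · rintro ⟨hz, hzb⟩
      have hcl : IsClosed {w : Amb n | w.snd = k • w.fst} :=
        isClosed_eq continuous_ambSnd (continuous_ambFst.const_smul k)
      have h : z.snd = k • z.fst := closure_minimal
        (fun w hw => hw.2.trans (hgrad _ hw.1)) hcl hz
      exact ⟨h, (hlt h).2 hzb⟩
    · rintro ⟨h, hz⟩
      have hzb := (hlt h).1 hz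
      by_cases h0 : z.fst = 0
      · obtain ⟨y, hy⟩ := exists_norm_eq_one n
        convert mem_completedGraph_of_tendsto hb hradial hf hlim hy using 1
        refine amb_ext h0 ?_
        rw [h, h0]
        simp
      · have hx : z.fst ∈ puncturedBall n b := ⟨norm_pos_iff.2 h0, hzb⟩
        exact gradientGraph_subset_completedGraph ⟨hx, h.trans (hgrad _ hx).symm⟩

end completion

/-! ### Rotation of a regular curve -/

section rotation
variable {n : ℕ} {R V : ℝ → ℝ}

/-- The map `(t, y) ↦ (R(t) y, V(t) y)`, which sweeps out the curve `(R, V)` by the rotations acting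
diagonally on `ℝⁿ × ℝⁿ` when `y` runs through the unit sphere. -/
def sweep (n : ℕ) (R V : ℝ → ℝ) (p : ℝ × Euc n) : Amb n :=
  WithLp.toLp 2 (R p.1 • p.2, V p.1 • p.2)

lemma contDiffOn_sweep (hR : ContDiffOn ℝ ∞ R (Ici 0)) (hV : ContDiffOn ℝ ∞ V (Ici 0)) :
    ContDiffOn ℝ ∞ (sweep n R V) (Ici 0 ×ˢ univ) := by
  have h1 : MapsTo (Prod.fst : ℝ × Euc n → ℝ) (Ici 0 ×ˢ univ) (Ici 0) := fun p hp => hp.1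
  exact (WithLp.prodContinuousLinearEquiv 2 ℝ (Euc n) (Euc n)).symm.contDiff.comp_contDiffOn
    (((hR.comp contDiffOn_fst h1).smul contDiffOn_snd).prodMk
      ((hV.comp contDiffOn_fst h1).smul contDiffOn_snd))

lemma hasFDerivWithinAt_sweep {R' V' t : ℝ} (hR : HasDerivWithinAt R R' (Ici 0) t)
    (hV : HasDerivWithinAt V V' (Ici 0) t) (y : Euc n) :
    ∃ D : ℝ × Euc n →L[ℝ] Amb n, HasFDerivWithinAt (sweep n R V) D (Ici 0 ×ˢ univ) (t, y) ∧
      ∀ τ w, D (τ, w) = WithLp.toLp 2 (R t • w + (τ * R') • y, V t • w + (τ * V') • y) := by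
  have h1 : MapsTo (Prod.fst : ℝ × Euc n → ℝ) (Ici 0 ×ˢ univ) (Ici 0) := fun p hp => hp.1
  have hfst : HasFDerivWithinAt (Prod.fst : ℝ × Euc n → ℝ) (ContinuousLinearMap.fst ℝ ℝ (Euc n))
      (Ici 0 ×ˢ univ) (t, y) :=
    hasFDerivWithinAt_fst
  have hsnd : HasFDerivWithinAt (Prod.snd : ℝ × Euc n → Euc n) (ContinuousLinearMap.snd ℝ ℝ (Euc n))
      (Ici 0 ×ˢ univ) (t, y) :=
    hasFDerivWithinAt_snd
  have h2 := (hR.hasFDerivWithinAt.comp (t, y) hfst h1).smul hsnd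
  have h3 := (hV.hasFDerivWithinAt.comp (t, y) hfst h1).smul hsnd
  have h4 := (WithLp.prodContinuousLinearEquiv 2 ℝ (Euc n)
    (Euc n)).symm.hasFDerivAt.comp_hasFDerivWithinAt (t, y) (h2.prodMk h3)
  refine ⟨_, h4, fun τ w => ?_⟩
  rfl

/-- Radial and tangential displacements of a point of the unit sphere are independent. -/
lemma eq_zero_of_smul_add_smul_eq_zero {y w : Euc n} (hy : ‖y‖ = 1) (hyw : inner ℝ y w = 0)
    {a s : ℝ} (h : a • w + s • y = 0) : a • w = 0 ∧ s = 0 := by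
  have h1 := congrArg (inner ℝ y) h
  rw [inner_add_right, inner_smul_right, inner_smul_right, hyw, real_inner_self_eq_norm_sq, hy,
    inner_zero_right] at h1
  have hs : s = 0 := by linarith
  rw [hs, zero_smul, add_zero] at h
  exact ⟨h, hs⟩

/-- Rotating a regular curve `(R, V)` that starts at a point of the axis `R = 0` other than the
origin gives a properly embedded half cylinder: the velocity of the curve moves a point of the sphere
radially in each factor, the rotations move it tangentially, and properness holds because `R` tends
to `b`. -/
lemma isProperlyEmbeddedHalfCylinder_sweep [NeZero n] {b : ℝ} {R' V' : ℝ → ℝ} {M B : Set (Amb n)}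
    (hM : M ⊆ tube n b) (hRmono : StrictMonoOn R (Ici 0)) (hR0 : R 0 = 0) (hV0 : V 0 ≠ 0)
    (hRimage : R '' Ioi 0 = Ioo 0 b)
    (hR : ContDiffOn ℝ ∞ R (Ici 0)) (hV : ContDiffOn ℝ ∞ V (Ici 0))
    (hR' : ∀ t ∈ Ici 0, HasDerivWithinAt R (R' t) (Ici 0) t)
    (hV' : ∀ t ∈ Ici 0, HasDerivWithinAt V (V' t) (Ici 0) t)
    (hreg : ∀ t ∈ Ici 0, R' t ≠ 0 ∨ V' t ≠ 0)
    (himage : (fun p : ℝ × UnitSphere n => sweep n R V (p.1, p.2)) '' halfCylinder n = M)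
    (hboundary : (fun p : ℝ × UnitSphere n => sweep n R V (p.1, p.2)) '' ({0} ×ˢ univ) = B) :
    IsProperlyEmbeddedHalfCylinder M B (tube n b) := by
  set F : ℝ × UnitSphere n → Amb n := fun p => sweep n R V (p.1, p.2) with hF
  have hmaps : MapsTo (fun p : ℝ × UnitSphere n => ((p.1, p.2) : ℝ × Euc n)) (halfCylinder n)
      (Ici 0 ×ˢ univ) := fun p hp => ⟨hp.1, mem_univ _⟩
  have hj : ContMDiff (𝓘(ℝ, ℝ).prod (𝓡 (n - 1))) 𝓘(ℝ, ℝ × Euc n) ∞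
      fun p : ℝ × UnitSphere n => ((p.1, p.2) : ℝ × Euc n) :=
    contMDiff_fst.prodMk_space (contMDiff_coe_sphere.comp contMDiff_snd)
  have hFsm : ContMDiffOn (𝓘(ℝ, ℝ).prod (𝓡 (n - 1))) 𝓘(ℝ, Amb n) ∞ F (halfCylinder n) :=
    (contDiffOn_sweep hR hV).contMDiffOn.comp hj.contMDiffOn hmaps
  have hRV : ∀ t ∈ Ici 0, R t ≠ 0 ∨ V t ≠ 0 := fun t ht => by
    rcases eq_or_lt_of_le (mem_Ici.1 ht) with h | h
    · exact Or.inr (h ▸ hV0)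
    · exact Or.inl (hR0 ▸ (hRmono self_mem_Ici ht h)).ne'
  have hnorm : ∀ y : UnitSphere n, ‖(y : Euc n)‖ = 1 := fun y => by simp
  have hFfst : ∀ p ∈ halfCylinder n, ‖(F p).fst‖ = R p.1 := fun p hp => by
    have h0 : 0 ≤ R p.1 := hR0 ▸ hRmono.monotoneOn self_mem_Ici hp.1 hp.1
    change ‖R p.1 • (p.2 : Euc n)‖ = R p.1
    rw [norm_smul, hnorm, mul_one, Real.norm_of_nonneg h0]
  refine ⟨hM, F, hFsm, fun p hp => ?_, fun p hp q hq hpq => ?_, fun K hKU hK => ?_, himage,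
    hboundary⟩
  · obtain ⟨t, y⟩ := p
    obtain ⟨D, hD, hDapply⟩ := hasFDerivWithinAt_sweep (hR' t hp.1) (hV' t hp.1) (y : Euc n)
    have hcoe : MDifferentiableAt (𝓡 (n - 1)) 𝓘(ℝ, Euc n)
        ((↑) : UnitSphere n → Euc n) y :=
      (contMDiff_coe_sphere (m := 1)).mdifferentiableAt one_ne_zero
    have hj' : HasMFDerivAt (𝓘(ℝ, ℝ).prod (𝓡 (n - 1))) 𝓘(ℝ, ℝ × Euc n)
        (fun p : ℝ × UnitSphere n => ((p.1, p.2) : ℝ × Euc n)) (t, y)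
        ((ContinuousLinearMap.fst ℝ (TangentSpace 𝓘(ℝ, ℝ) t) (TangentSpace (𝓡 (n - 1)) y)).prod
          ((mfderiv (𝓡 (n - 1)) 𝓘(ℝ, Euc n) ((↑) : UnitSphere n → Euc n) y).comp
            (ContinuousLinearMap.snd ℝ (TangentSpace 𝓘(ℝ, ℝ) t)
              (TangentSpace (𝓡 (n - 1)) y)))) := by
      rw [modelWithCornersSelf_prod, ← chartedSpaceSelf_prod]
      exact HasMFDerivAt.prodMk (hasMFDerivAt_fst (t, y))
        (HasMFDerivAt.comp (t, y) hcoe.hasMFDerivAt (hasMFDerivAt_snd (t, y)))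
    have hF' := hD.hasMFDerivWithinAt.comp (t, y) (hj'.hasMFDerivWithinAt (s := halfCylinder n))
      hmaps
    have huniq : UniqueMDiffOn (𝓘(ℝ, ℝ).prod (𝓡 (n - 1))) (halfCylinder n) :=
      (uniqueDiffOn_Ici (0 : ℝ)).uniqueMDiffOn.prod uniqueMDiffOn_univ
    have hmf := hF'.mfderivWithin (huniq _ hp)
    have hFj : F = sweep n R V ∘ fun p : ℝ × UnitSphere n => ((p.1, p.2) : ℝ × Euc n) := rfl
    rw [hFj, hmf]
    refine (injective_iff_map_eq_zero _).2 ?_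
    rintro ⟨τ, ξ⟩ h
    set w : Euc n := mfderiv (𝓡 (n - 1)) 𝓘(ℝ, Euc n) ((↑) : UnitSphere n → Euc n) y ξ with hw
    have hDw : D (τ, w) = 0 := h
    have hyw : inner ℝ (y : Euc n) w = 0 := by
      have h1 : w ∈ (ℝ ∙ (y : Euc n))ᗮ := by
        rw [← range_mvfderiv_subtypeVal (n := n - 1) y]
        exact ⟨ξ, rfl⟩
      exact Submodule.mem_orthogonal_singleton_iff_inner_right.1 h1
    rw [hDapply] at hDw
    obtain ⟨h1, h2⟩ := eq_zero_of_smul_add_smul_eq_zero (hnorm y) hyw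
      (congrArg (fun z : Amb n => z.fst) hDw)
    obtain ⟨h3, h4⟩ := eq_zero_of_smul_add_smul_eq_zero (hnorm y) hyw
      (congrArg (fun z : Amb n => z.snd) hDw)
    have hτ : τ = 0 := by
      rcases hreg t hp.1 with h | h
      · exact (mul_eq_zero.1 h2).resolve_right h
      · exact (mul_eq_zero.1 h4).resolve_right h
    have hw0 : w = 0 := by
      rcases hRV t hp.1 with h | h
      · exact (smul_eq_zero.1 h1).resolve_left h
      · exact (smul_eq_zero.1 h3).resolve_left h
    have hξ : ξ = 0 := injective_mvfderiv_subtypeVal_sphere (n := n - 1) y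
      (hw0.trans (map_zero (mfderiv (𝓡 (n - 1)) 𝓘(ℝ, Euc n)
        ((↑) : UnitSphere n → Euc n) y)).symm)
    rw [hτ, hξ]
    rfl
  · have ht : p.1 = q.1 := by
      refine hRmono.injOn hp.1 hq.1 ?_
      rw [← hFfst p hp, ← hFfst q hq, hpq]
    refine Prod.ext ht (Subtype.ext ?_)
    have h1 : R p.1 • (p.2 : Euc n) = R q.1 • (q.2 : Euc n) :=
      congrArg (fun z : Amb n => z.fst) hpq
    have h2 : V p.1 • (p.2 : Euc n) = V q.1 • (q.2 : Euc n) :=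
      congrArg (fun z : Amb n => z.snd) hpq
    rw [← ht] at h1 h2
    rcases hRV p.1 hp.1 with h | h
    · exact smul_right_injective _ h h1
    · exact smul_right_injective _ h h2
  · have hclosed : IsClosed (halfCylinder n ∩ F ⁻¹' K) :=
      hFsm.continuousOn.preimage_isClosed_of_isClosed (isClosed_Ici.prod isClosed_univ)
        hK.isClosed
    rcases K.eq_empty_or_nonempty with hKe | hKne
    · simp [hKe]
    obtain ⟨z, hzK, hz⟩ := hK.exists_isMaxOn hKne continuous_ambFst.norm.continuousOn
    -- `K` stays away from `|x| = b`, which bounds the time parameter on its preimage.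
    obtain ⟨r, hzr, hrb⟩ := exists_between (show ‖z.fst‖ < b from hKU hzK)
    obtain ⟨T, hT, hTr⟩ : r ∈ R '' Ioi 0 := by
      rw [hRimage]
      exact ⟨(norm_nonneg _).trans_lt hzr, hrb⟩
    refine (isCompact_Icc.prod isCompact_univ : IsCompact (Icc 0 T ×ˢ
      (univ : Set (UnitSphere n)))).of_isClosed_subset hclosed ?_
    rintro p ⟨hp, hpK⟩
    refine ⟨⟨hp.1, ?_⟩, mem_univ _⟩
    have h1 : R p.1 ≤ ‖z.fst‖ := by
      rw [← hFfst p hp]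
      exact hz hpK
    exact (hRmono.le_iff_le hp.1 (mem_Ici.2 (le_of_lt hT))).1 (by linarith)

/-- The completed graph of a profile whose slope tends to `c ≠ 0` is swept out by the smooth
completed profile curve. -/
lemma isProperlyEmbeddedHalfCylinder_union [NeZero n] {b c C : ℝ} {u : Euc n → ℝ} {f : ℝ → ℝ}
    (hb : 0 < b) (hradial : ∀ x ∈ puncturedBall n b, u x = f ‖x‖)
    (hf : ContDiffOn ℝ ∞ f (Ioo 0 b)) (hc : c ≠ 0)
    (hC : ∀ r ∈ Ioo 0 b, deriv (phaseProfile n f) r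
      = C * √(1 + deriv (deriv f) r ^ 2) / √(r ^ 2 + deriv f r ^ 2) ^ (n - 1))
    (hlim : Tendsto (deriv f) (𝓝[>] 0) (𝓝 c)) :
    IsProperlyEmbeddedHalfCylinder
      (gradientGraph u (puncturedBall n b) ∪ sphereOverOrigin n |c|)
      (sphereOverOrigin n |c|) (tube n b) := by
  obtain ⟨R, V, R', V', hR0, hV0, hRmono, hRimage, hVeq, hR, hV, hR', hV', hreg⟩ :=
    exists_profile_parametrization hb hf hc hC hlim
  have hboundary : (fun p : ℝ × UnitSphere n => sweep n R V (p.1, p.2)) '' ({0} ×ˢ univ)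
      = sphereOverOrigin n |c| := by
    refine Subset.antisymm ?_ ?_
    · rintro _ ⟨⟨t, y⟩, ⟨ht, -⟩, rfl⟩
      obtain rfl : t = 0 := ht
      refine ⟨?_, ?_⟩
      · change R 0 • (y : Euc n) = 0
        rw [hR0, zero_smul]
      · change ‖V 0 • (y : Euc n)‖ = |c|
        rw [hV0, norm_smul, norm_eq_of_mem_sphere, mul_one, Real.norm_eq_abs]
    · rintro z ⟨hz1, hz2⟩
      have hy : c⁻¹ • z.snd ∈ sphere (0 : Euc n) 1 := by
        rw [mem_sphere_zero_iff_norm, norm_smul, hz2, norm_inv, Real.norm_eq_abs,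
          inv_mul_cancel₀ (abs_ne_zero.2 hc)]
      refine ⟨(0, ⟨_, hy⟩), ⟨rfl, mem_univ _⟩, amb_ext ?_ ?_⟩
      · change R 0 • c⁻¹ • z.snd = z.fst
        rw [hR0, zero_smul, hz1]
      · change V 0 • c⁻¹ • z.snd = z.snd
        rw [hV0, smul_inv_smul₀ hc]
  have hinterior : (fun p : ℝ × UnitSphere n => sweep n R V (p.1, p.2)) '' (Ioi 0 ×ˢ univ)
      = gradientGraph u (puncturedBall n b) := by
    refine Subset.antisymm ?_ ?_
    · rintro _ ⟨⟨t, y⟩, ⟨ht, -⟩, rfl⟩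
      have hr : R t ∈ Ioo 0 b := hRimage ▸ mem_image_of_mem R ht
      have h := smul_mem_gradientGraph hradial hf hr (norm_eq_of_mem_sphere y)
      rwa [← hVeq t ht] at h
    · rintro z ⟨hz1, hz2⟩
      obtain ⟨t, ht, htr⟩ : ‖z.fst‖ ∈ R '' Ioi 0 := by
        rw [hRimage]
        exact hz1
      have h0 : ‖z.fst‖ ≠ 0 := hz1.1.ne'
      have hy : ‖z.fst‖⁻¹ • z.fst ∈ sphere (0 : Euc n) 1 := by
        rw [mem_sphere_zero_iff_norm, norm_smul, norm_inv, norm_norm, inv_mul_cancel₀ h0]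
      refine ⟨(t, ⟨_, hy⟩), ⟨ht, mem_univ _⟩, amb_ext ?_ ?_⟩
      · change R t • ‖z.fst‖⁻¹ • z.fst = z.fst
        rw [htr, smul_inv_smul₀ h0]
      · change V t • ‖z.fst‖⁻¹ • z.fst = z.snd
        rw [hVeq t ht, htr, hz2, gradient_radial hradial hf hz1, smul_smul, div_eq_mul_inv]
  have himage : (fun p : ℝ × UnitSphere n => sweep n R V (p.1, p.2)) '' halfCylinder n
      = gradientGraph u (puncturedBall n b) ∪ sphereOverOrigin n |c| := by
    rw [← hinterior, ← hboundary, ← image_union, ← union_prod, halfCylinder, Ioi_union_left]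
  refine isProperlyEmbeddedHalfCylinder_sweep ?_ hRmono hR0 (hV0 ▸ hc) hRimage hR hV hR' hV' hreg
    himage hboundary
  rw [← completedGraph_eq_of_tendsto hb hradial hf hc hlim]
  exact inter_subset_right

end rotation

end

theorem theorem2 (n : ℕ) [n.AtLeastTwo] (b : ℝ) (hb : 0 < b)
    (u : Euc n → ℝ) (f : ℝ → ℝ)
    (hradial : ∀ x ∈ puncturedBall n b, u x = f ‖x‖)
    (hu : IsHamiltonianStationary u (puncturedBall n b)) :
    (Tendsto (deriv f) (𝓝[>] 0) (𝓝 0) →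
      IsSpecialLagrangian u (puncturedBall n b) ∧
      (∃ a k : ℝ, ∀ x ∈ puncturedBall n b, u x = a + k / 2 * ‖x‖ ^ 2) ∧
      IsFlatDisk (completedGraph u b)) ∧
    (∀ c : ℝ, c ≠ 0 → Tendsto (deriv f) (𝓝[>] 0) (𝓝 c) →
      completedGraph u b =
        gradientGraph u (puncturedBall n b) ∪ sphereOverOrigin n |c| ∧
      IsProperlyEmbeddedHalfCylinder
        (gradientGraph u (puncturedBall n b) ∪ sphereOverOrigin n |c|)
        (sphereOverOrigin n |c|) (tube n b)) := by
  have hn : 2 ≤ n := Nat.AtLeastTwo.prop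
  have hf := contDiffOn_profile hradial hu.1
  obtain ⟨C, hC⟩ := exists_phaseProfile_deriv hradial hf hu.2
  refine ⟨fun hlim => ?_, fun c hc hlim => ⟨completedGraph_eq_of_tendsto hb hradial hf hc hlim,
    isProperlyEmbeddedHalfCylinder_union hb hradial hf hc hC hlim⟩⟩
  have hC0 := flux_eq_zero hn hb hf hC hlim
  have hΘ : ∀ r ∈ Ioo 0 b, deriv (phaseProfile n f) r = 0 := fun r hr => by
    rw [hC r hr, hC0, zero_mul, zero_div]
  obtain ⟨k, hk⟩ := deriv_eq_mul_of_phase_const hn hb hf hΘ hlim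
  obtain ⟨a, ha⟩ := eq_quadratic_of_deriv_eq_mul hf hk
  refine ⟨⟨hu.1, fun x hx => ?_⟩, ⟨a, k, fun x hx => ?_⟩,
    isFlatDisk_completedGraph hb hradial hf hlim hk⟩
  · ext i
    rw [graphGradient_radial hradial hf hx, hΘ _ (norm_mem_Ioo hx)]
    simp
  · rw [hradial x hx, ha _ (norm_mem_Ioo hx)]
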